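/- **Setting.** Let $M$ be a compact $C^\infty$ Riemannian manifold without boundary, of dimension $n$, with its Riemannian distance, and fix a finite smooth atlas $\mathcal A=\{(U,\varphi)\}$ of $M$. Let $0<\theta<1$ and $1\le k\le n-1$. For a function $f$ on a subset of a metric space put $\|f\|_{C^\theta}=\sup_x|f(x)|+\sup_{x\ne y}\frac{|f(x)-f(y)|}{d(x,y)^\theta}$. For a $k$-form $\alpha$ on $M$ write $(\varphi^{-1})^*\alpha=\sum_I a_I^\varphi\,dx_I$ on $\varphi(U)\subset\mathbb R^n$ (sum over increasing multi-indices $I$), and let $\|\alpha\|_{C^\theta}=\max_{(U,\varphi)\in\mathcal A}\max_I\|a_I^\varphi\|_{C^\theta}$, where the norm of $a_I^\varphi$ is taken over $\varphi(U)$ with the Euclidean distance. The form $\alpha$ is of class $C^\theta$ if $\|\alpha\|_{C^\theta}<\infty$. A *$C^1$-immersed $(k+1)$-disk $D$ in $M$ with piecewise $C^1$ boundary* is given by a set $B\subset\mathbb R^{k+1}$ homeomorphic to the closed unit ball and a map $f$ into $M$ that is $C^1$ in a neighbourhood of $B$, with injective differential at every point of $B$, where $\partial B$ is the union of finitely many pieces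 $\psi_j([0,1]^k)$ with the following properties: each $\psi_j$ is $C^1$ on $[0,1]^k$; on the open cube $\psi_j$ is an injective immersion, positively oriented for the boundary orientation of $\partial B$ (outward vector first), with $B$ lying on one side of the piece; the images of the open cube under different $\psi_j$ are disjoint. Write $\partial D=f(\partial B)$ for the boundary set, $|D|=\int_B\sqrt{\det\big(\langle\partial_i f,\partial_l f\rangle\big)}\,dx$ and $|\partial D|=\sum_j\int_{[0,1]^k}\sqrt{\det\big(\langle\partial_i(f\circ\psi_j),\partial_l(f\circ\psi_j)\rangle\big)}\,du$ for the Riemannian volumes, and $\int_{\partial D}\alpha=\sum_j\int_{[0,1]^k}(f\circ\psi_j)^*\alpha$. **Theorem A.** There are constants $\sigma,K>0$, depending only on $M$ (with its Riemannian metric and the fixed atlas), $\theta$ and $k$, such that for every $k$-form $\alpha$ of class $C^\theta$ on $M$ and every $C^1$-immersed $(k+1)$-disk $D$ in $M$ with piecewise $C^1$ boundary satisfying $\max\{\operatorname{diam}(\partial D),|\partial D|\}<\sigma$, one has $$\left|\int_{\partial D}\alpha\right|\le K\,\|\alpha\|_{C^\theta}\,|\partial D|^{1-\theta}\,|D|^\theta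 .$$ -/

import Mathlib

open MeasureTheory Set Manifold Bundle
open scoped ENNReal NNReal Topology ContDiff

noncomputable section

/-- The closed unit cube `[0,1]^k`. -/
def unitCube (k : ℕ) : Set (Fin k → ℝ) := Icc 0 1

/-- `ν` points out of `B` at `p`: moving from `p` in direction `ν` leaves `B` at once, moving in
direction `-ν` enters the interior of `B` at once. -/
def PointsOutward {k : ℕ} (B : Set (Fin (k + 1) → ℝ)) (p ν : Fin (k + 1) → ℝ) : Prop :=
  ∀ᶠ t : ℝ in 𝓝[>] 0, p + t • ν ∉ B ∧ p - t • ν ∈ interior B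

/-- A `(k+1)`-disk with piecewise `C^1` boundary in `ℝ^(k+1)`: a set homeomorphic to the closed
unit ball, whose boundary is cut into finitely many `C^1` pieces. Each piece is a `C^1` image of the
closed cube `[0,1]^k`. In the open cube the parametrization is injective, immersive and positively
oriented for the boundary orientation (outward vector first); on the boundary of the cube it may
degenerate, so that triangular pieces and the like are included. The open pieces do not overlap. -/
structure DiskDomain (k : ℕ) where
  /-- The underlying compact set. -/
  carrier : Set (Fin (k + 1) → ℝ)
  homeo_ball : Nonempty (carrier ≃ₜ Metric.closedBall (0 : EuclideanSpace ℝ (Fin (k + 1))) 1)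
  /-- The number of boundary pieces. -/
  numPieces : ℕ
  /-- The parametrizations of the boundary pieces. -/
  piece : Fin numPieces → (Fin k → ℝ) → (Fin (k + 1) → ℝ)
  contDiffOn_piece : ∀ j, ContDiffOn ℝ 1 (piece j) (unitCube k)
  frontier_eq : frontier carrier = ⋃ j, piece j '' unitCube k
  injOn_piece : ∀ j, InjOn (piece j) (interior (unitCube k))
  disjoint_pieces : ∀ i j, i ≠ j →
    Disjoint (piece i '' interior (unitCube k)) (piece j '' interior (unitCube k))
  /-- A positive determinant also forces the differential of the piece to be injective. -/
  oriented : ∀ j, ∀ u ∈ interior (unitCube k), ∃ ν : Fin (k + 1) → ℝ,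
    PointsOutward carrier (piece j u) ν ∧
      0 < Matrix.det (Matrix.of (Fin.cons ν fun i : Fin k =>
        fderivWithin ℝ (piece j) (unitCube k) u (Pi.single i 1)))

section Manifold

variable {n : ℕ} {M : Type*} [TopologicalSpace M] [ChartedSpace (EuclideanSpace ℝ (Fin n)) M]

/-- A differential `k`-form on `M` (no regularity). -/
abbrev DiffForm (n : ℕ) (M : Type*) [TopologicalSpace M]
    [ChartedSpace (EuclideanSpace ℝ (Fin n)) M] (k : ℕ) : Type _ :=
  (x : M) → (TangentSpace (𝓡 n) x) [⋀^Fin k]→L[ℝ] ℝ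

/-- The coefficient `a_I` of `(φ⁻¹)^* α = ∑_I a_I dx_I` in the chart `φ`, for an increasing
multi-index `I`. -/
def DiffForm.coeff {k : ℕ} (α : DiffForm n M k)
    (φ : OpenPartialHomeomorph M (EuclideanSpace ℝ (Fin n))) (I : Fin k ↪o Fin n)
    (y : EuclideanSpace ℝ (Fin n)) : ℝ :=
  α (φ.symm y) fun i => mfderiv (𝓡 n) (𝓡 n) φ.symm y (EuclideanSpace.single (I i) (1 : ℝ))

/-- The `C^θ` norm `sup |f| + H_θ(f)` of a function on a set, possibly infinite. -/
def holderNormOn {X : Type*} [PseudoEMetricSpace X] (θ : ℝ≥0) (s : Set X) (f : X → ℝ) : ℝ≥0∞ :=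
  (⨆ x ∈ s, ‖f x‖ₑ) + eHolderNorm θ (fun x : s => f x)

/-- `A` is a finite smooth atlas of the smooth manifold `M`. -/
def IsFiniteAtlas (A : Set (OpenPartialHomeomorph M (EuclideanSpace ℝ (Fin n)))) : Prop :=
  A.Finite ∧ A ⊆ IsManifold.maximalAtlas (𝓡 n) ∞ M ∧ ∀ x : M, ∃ φ ∈ A, x ∈ φ.source

/-- The `C^θ` norm of a form with respect to an atlas: the maximum over the charts and over the
multi-indices of the `C^θ` norms of the coefficients on the image of the chart. The form is of
class `C^θ` when this is finite. -/
def DiffForm.holderNorm {k : ℕ} (A : Set (OpenPartialHomeomorph M (EuclideanSpace ℝ (Fin n))))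
    (θ : ℝ≥0) (α : DiffForm n M k) : ℝ≥0∞ :=
  ⨆ φ ∈ A, ⨆ I : Fin k ↪o Fin n, holderNormOn θ φ.target (α.coeff φ I)

/-- A `C^1`-immersed `(k+1)`-disk in `M` with piecewise `C^1` boundary. Being `C^1` at each point
of the compact domain is the same as being `C^1` in a neighbourhood of it. -/
structure ImmersedDisk (n : ℕ) (M : Type*) [TopologicalSpace M]
    [ChartedSpace (EuclideanSpace ℝ (Fin n)) M] (k : ℕ) extends DiskDomain k where
  /-- The immersion; its values away from the domain play no role. -/
  toFun : (Fin (k + 1) → ℝ) → M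
  contMDiffAt : ∀ x ∈ carrier, ContMDiffAt 𝓘(ℝ, Fin (k + 1) → ℝ) (𝓡 n) 1 toFun x
  immersion : ∀ x ∈ carrier,
    Function.Injective (mfderiv 𝓘(ℝ, Fin (k + 1) → ℝ) (𝓡 n) toFun x)

namespace ImmersedDisk

variable {k : ℕ} (D : ImmersedDisk n M k)

/-- The set `∂D` in `M`. -/
def boundary : Set M := D.toFun '' frontier D.carrier

/-- The `i`-th coordinate vector of the boundary piece `j` of `D`, that is `∂(f ∘ ψ_j)/∂u_i`. -/
def boundaryVec (j : Fin D.numPieces) (u : Fin k → ℝ) (i : Fin k) :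
    TangentSpace (𝓡 n) (D.toFun (D.piece j u)) :=
  mfderiv 𝓘(ℝ, Fin (k + 1) → ℝ) (𝓡 n) D.toFun (D.piece j u)
    (fderivWithin ℝ (D.piece j) (unitCube k) u (Pi.single i 1))

/-- The integral `∫_{∂D} α`. -/
def boundaryIntegral (α : DiffForm n M k) : ℝ :=
  ∑ j, ∫ u in unitCube k, α (D.toFun (D.piece j u)) (D.boundaryVec j u)

variable [RiemannianBundle (fun x : M => TangentSpace (𝓡 n) x)]

/-- The Riemannian `(k+1)`-volume `|D|`. -/
def vol : ℝ≥0∞ :=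
  ∫⁻ x in D.carrier, ENNReal.ofReal (Real.sqrt (Matrix.det (Matrix.gram ℝ
    fun i : Fin (k + 1) => (mfderiv 𝓘(ℝ, Fin (k + 1) → ℝ) (𝓡 n) D.toFun x
      (Pi.single i (1 : ℝ) : Fin (k + 1) → ℝ) : TangentSpace (𝓡 n) (D.toFun x)))))

/-- The Riemannian `k`-volume `|∂D|`. -/
def boundaryVol : ℝ≥0∞ :=
  ∑ j, ∫⁻ u in unitCube k,
    ENNReal.ofReal (Real.sqrt (Matrix.det (Matrix.gram ℝ (D.boundaryVec j u))))

end ImmersedDisk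

end Manifold

end

/-!
By a partition of unity and the expansion of `α` in coordinates, `∫_{∂D} α` is a finite sum of
integrals of `a dX_{I₁} ∧ ⋯ ∧ dX_{I_k}` over `∂D`, with `a` Hölder of norm `H ≤ ‖α‖` and with `C^1`
functions `X_i` whose differentials are bounded by compactness. At scale `0 < ε ≤ 1`, `a` is
approximated within `O(H ε^θ)` by a smooth function whose gradient is `O(H ε^(θ - 1))`. The error
integrates to `O(H ε^θ |∂D|)`, and by Stokes' theorem the approximation integrates to
`O(H ε^(θ - 1) |D|)`; the choice `ε = |D| / |∂D|` balances the two terms. If `|D| ≥ |∂D|`, the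
trivial bound `O(H |∂D|)` suffices.

Stokes' theorem is needed on a domain whose boundary is only piecewise `C^1`, for `C^1` functions.
It follows from the divergence theorem, which is the fundamental theorem of calculus on almost every
coordinate line: such a line meets the boundary transversally, in finitely many points of the open
pieces, and the area formula for the projected pieces sums over these points. The closedness of
`dg₁ ∧ ⋯ ∧ dg_k` requires `C^2` functions; a mollification removes this assumption.
-/

section Line

/-- The point `t` is an end point of `S ⊆ ℝ` with outward direction `ε`, where `ε = 1` for a right
end point and `ε = -1` for a left one. -/
def IsEndpoint (S : Set ℝ) (ε t : ℝ) : Prop :=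
  (ε = 1 ∨ ε = -1) ∧ ∀ᶠ τ in 𝓝[>] (0 : ℝ), t + ε * τ ∉ S ∧ t - ε * τ ∈ S

/-- The half-line to the left of `t`, containing `t` exactly when `ε = 1`. With this convention the
indicator of a compact set is the signed sum of the half-lines of its end points at every point, and
not only almost everywhere. -/
def endpointRay (ε t : ℝ) : Set ℝ := {x | x < t ∨ x = t ∧ ε = 1}

variable {S : Set ℝ} {ε t : ℝ}

theorem eventually_mem_iff_of_notMem_frontier {X : Type*} [TopologicalSpace X] {s : Set X} {x : X}
    (hx : x ∉ frontier s) : ∀ᶠ y in 𝓝 x, y ∈ s ↔ x ∈ s := by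
  by_cases hxs : x ∈ s
  · have hint : x ∈ interior s := by
      by_contra h
      exact hx ⟨subset_closure hxs, h⟩
    filter_upwards [mem_interior_iff_mem_nhds.1 hint] with y hy using iff_of_true hy hxs
  · have hcl : x ∉ closure s := fun h => hx ⟨h, fun h' => hxs (interior_subset h')⟩
    filter_upwards [isClosed_closure.isOpen_compl.mem_nhds hcl] with y hy using
      iff_of_false (fun h => hy (subset_closure h)) hxs

theorem tendsto_sub_nhdsGT_zero (t : ℝ) : Filter.Tendsto (fun x => x - t) (𝓝[>] t) (𝓝[>] 0) := by
  refine tendsto_nhdsWithin_iff.2 ⟨?_, ?_⟩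
  · exact ((continuous_sub_right t).tendsto' _ _ (sub_self t)).mono_left nhdsWithin_le_nhds
  · filter_upwards [self_mem_nhdsWithin] with x hx using sub_pos.2 (mem_Ioi.1 hx)

theorem tendsto_sub_nhdsLT_zero (t : ℝ) : Filter.Tendsto (fun x => t - x) (𝓝[<] t) (𝓝[>] 0) := by
  refine tendsto_nhdsWithin_iff.2 ⟨?_, ?_⟩
  · exact ((continuous_sub_left t).tendsto' _ _ (sub_self t)).mono_left nhdsWithin_le_nhds
  · filter_upwards [self_mem_nhdsWithin] with x hx using sub_pos.2 (mem_Iio.1 hx)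

theorem eventually_nhds_of_nhdsLT_of_nhdsGT {p : ℝ → Prop} (hlt : ∀ᶠ x in 𝓝[<] t, p x) (ht : p t)
    (hgt : ∀ᶠ x in 𝓝[>] t, p x) : ∀ᶠ x in 𝓝 t, p x := by
  rw [← nhdsLT_sup_nhdsGE, ← Ioi_insert, nhdsWithin_insert]
  simp only [Filter.eventually_sup, Filter.eventually_pure]
  exact ⟨hlt, ht, hgt⟩

theorem eventually_mem_endpointRay_iff_of_ne {x : ℝ} (hx : x ≠ t) :
    ∀ᶠ y in 𝓝 x, y ∈ endpointRay ε t ↔ x ∈ endpointRay ε t := by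
  rcases lt_or_gt_of_ne hx with h | h
  · filter_upwards [eventually_lt_nhds h] with y hy using iff_of_true (Or.inl hy) (Or.inl h)
  · filter_upwards [eventually_gt_nhds h] with y hy using
      iff_of_false (fun hy' => hy'.elim hy.not_gt fun e => hy.ne' e.1)
        fun hx' => hx'.elim h.not_gt fun e => h.ne' e.1

namespace IsEndpoint

theorem mem_of_isClosed (h : IsEndpoint S ε t) (hS : IsClosed S) : t ∈ S := by
  have hlim : Filter.Tendsto (fun τ : ℝ => t - ε * τ) (𝓝[>] 0) (𝓝 t) := by
    have hc : Continuous fun τ : ℝ => t - ε * τ := by fun_prop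
    exact (hc.tendsto' 0 t (by simp)).mono_left nhdsWithin_le_nhds
  exact hS.mem_of_tendsto hlim (h.2.mono fun _ hτ => hτ.2)

/-- Near an end point the two jumps cancel. -/
theorem eventually_indicator_sub_eq (h : IsEndpoint S ε t) (hS : IsClosed S) :
    ∀ᶠ x in 𝓝 t, S.indicator 1 x - ε * (endpointRay ε t).indicator 1 x =
      S.indicator 1 t - ε * (endpointRay ε t).indicator (1 : ℝ → ℝ) t := by
  have htS := h.mem_of_isClosed hS
  have hne : (-1 : ℝ) ≠ 1 := by norm_num
  refine eventually_nhds_of_nhdsLT_of_nhdsGT ?_ rfl ?_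
  · filter_upwards [(tendsto_sub_nhdsLT_zero t).eventually h.2, self_mem_nhdsWithin] with x hx hxt
    rcases h.1 with rfl | rfl
    · have hxS : x ∈ S := by simpa using hx.2
      simp [indicator_of_mem, endpointRay, htS, hxS, mem_Iio.1 hxt]
    · have hxS : x ∉ S := by simpa using hx.1
      simp [indicator, endpointRay, htS, hxS, mem_Iio.1 hxt, hne]
  · filter_upwards [(tendsto_sub_nhdsGT_zero t).eventually h.2, self_mem_nhdsWithin] with x hx hxt
    have hxt' : ¬ x < t ∧ x ≠ t := ⟨(mem_Ioi.1 hxt).not_gt, (mem_Ioi.1 hxt).ne'⟩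
    rcases h.1 with rfl | rfl
    · have hxS : x ∉ S := by simpa using hx.1
      simp [indicator, endpointRay, htS, hxS, hxt']
    · have hxS : x ∈ S := by simpa using hx.2
      simp [indicator, endpointRay, htS, hxS, hxt', hne]

end IsEndpoint

variable {ι : Type*} [Fintype ι] {s t : ι → ℝ}

theorem isLocallyConstant_indicator_sub_sum_endpointRay (hS : IsClosed S)
    (ht : Function.Injective t) (hfr : frontier S ⊆ range t)
    (hs : ∀ a, IsEndpoint S (s a) (t a)) :
    IsLocallyConstant fun x =>
      S.indicator 1 x - ∑ a, s a * (endpointRay (s a) (t a)).indicator (1 : ℝ → ℝ) x := by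
  classical
  have hray : ∀ a x, x ≠ t a → ∀ᶠ y in 𝓝 x, s a * (endpointRay (s a) (t a)).indicator 1 y =
      s a * (endpointRay (s a) (t a)).indicator (1 : ℝ → ℝ) x := fun a x hx => by
    filter_upwards [eventually_mem_endpointRay_iff_of_ne (ε := s a) hx] with y hy
    simp only [indicator, hy, Pi.one_apply]
  rw [IsLocallyConstant.iff_eventually_eq]
  intro x
  by_cases hx : x ∈ range t
  · obtain ⟨a, rfl⟩ := hx
    have hothers : ∀ᶠ y in 𝓝 (t a), ∀ b ∈ Finset.univ.erase a,
        s b * (endpointRay (s b) (t b)).indicator 1 y =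
          s b * (endpointRay (s b) (t b)).indicator (1 : ℝ → ℝ) (t a) :=
      (Filter.eventually_all_finset _).2 fun b hb =>
        hray b (t a) (ht.ne (Finset.ne_of_mem_erase hb).symm)
    filter_upwards [hothers, (hs a).eventually_indicator_sub_eq hS] with y hy hya
    rw [← Finset.add_sum_erase _ _ (Finset.mem_univ a), Finset.sum_congr rfl hy, ← sub_sub, hya,
      sub_sub, Finset.add_sum_erase _ (fun b => s b * (endpointRay (s b) (t b)).indicator 1 (t a))
        (Finset.mem_univ a)]
  · have hall : ∀ᶠ y in 𝓝 x, ∀ a, s a * (endpointRay (s a) (t a)).indicator 1 y =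
        s a * (endpointRay (s a) (t a)).indicator (1 : ℝ → ℝ) x :=
      Filter.eventually_all.2 fun a => hray a x fun h => hx ⟨a, h.symm⟩
    filter_upwards [hall, eventually_mem_iff_of_notMem_frontier fun h => hx (hfr h)] with y hy hyS
    have hSy : S.indicator (1 : ℝ → ℝ) y = S.indicator 1 x := by
      simp only [indicator, hyS, Pi.one_apply]
    rw [hSy, Finset.sum_congr rfl fun a _ => hy a]

theorem indicator_eq_sum_endpointRay (hS : IsCompact S) (ht : Function.Injective t)
    (hfr : frontier S ⊆ range t) (hs : ∀ a, IsEndpoint S (s a) (t a)) (x : ℝ) :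
    S.indicator 1 x = ∑ a, s a * (endpointRay (s a) (t a)).indicator (1 : ℝ → ℝ) x := by
  obtain ⟨b, hb⟩ := hS.bddAbove
  have hbS : b + 1 ∉ S := fun h => (lt_add_one b).not_ge (hb h)
  have hbray : ∀ a, b + 1 ∉ endpointRay (s a) (t a) := fun a => by
    have hta := hb ((hs a).mem_of_isClosed hS.isClosed)
    rintro (h | ⟨h, -⟩) <;> linarith
  -- The difference of the two sides vanishes far to the right.
  have hconst := (isLocallyConstant_indicator_sub_sum_endpointRay hS.isClosed ht hfr
    hs).apply_eq_of_preconnectedSpace x (b + 1)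
  simp only [indicator_of_notMem hbS, indicator_of_notMem (hbray _), mul_zero,
    Finset.sum_const_zero, sub_zero] at hconst
  exact sub_eq_zero.1 hconst

theorem setIntegral_Ioc_endpointRay {a b ε t : ℝ} (hat : a ≤ t) (htb : t ≤ b)
    {g g' : ℝ → ℝ} (hg : ∀ x, HasDerivAt g (g' x) x) (hg' : Continuous g') :
    ∫ x in Ioc a b, (endpointRay ε t).indicator 1 x * g' x = g t - g a := by
  have hae : (fun x => (endpointRay ε t).indicator 1 x * g' x) =ᵐ[volume]
      (Iic t).indicator g' := by
    filter_upwards [Measure.ae_ne volume t] with x hx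
    simp [indicator, endpointRay, hx, le_iff_lt_or_eq]
  rw [integral_congr_ae (ae_restrict_of_ae hae), setIntegral_indicator measurableSet_Iic,
    Ioc_inter_Iic, min_eq_right htb, ← intervalIntegral.integral_of_le hat]
  exact intervalIntegral.integral_eq_sub_of_hasDerivAt (fun x _ => hg x)
    (hg'.intervalIntegrable _ _)

theorem setIntegral_eq_sum_endpoints (hS : IsCompact S) (ht : Function.Injective t)
    (hfr : frontier S ⊆ range t) (hs : ∀ a, IsEndpoint S (s a) (t a)) {g g' : ℝ → ℝ}
    (hg : ∀ x, HasDerivAt g (g' x) x) (hg' : Continuous g') :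
    ∫ x in S, g' x = ∑ i, s i * g (t i) := by
  have hind := indicator_eq_sum_endpointRay hS ht hfr hs
  obtain ⟨a, b, hab⟩ : ∃ a b, S ⊆ Ioc a b := by
    obtain ⟨a, b, h⟩ := bddBelow_bddAbove_iff_subset_Icc.1 ⟨hS.bddBelow, hS.bddAbove⟩
    exact ⟨a - 1, b, fun x hx => ⟨by linarith [(h hx).1], (h hx).2⟩⟩
  have htab : ∀ i, t i ∈ Ioc a b := fun i => hab ((hs i).mem_of_isClosed hS.isClosed)
  have hsum : ∑ i, s i = 0 := by
    have haS : a ∉ S := fun h => (hab h).1.false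
    have hray : ∀ i, a ∈ endpointRay (s i) (t i) := fun i => Or.inl (htab i).1
    simpa [indicator_of_notMem haS, indicator_of_mem (hray _)] using (hind a).symm
  have hint : ∀ i, IntegrableOn (fun x => s i * ((endpointRay (s i) (t i)).indicator 1 x * g' x))
      (Ioc a b) := fun i => by
    have hm : MeasurableSet (endpointRay (s i) (t i)) :=
      measurableSet_Iio.union ((measurableSet_singleton _).inter (.const _))
    simp_rw [← indicator_mul_left, Pi.one_apply, one_mul]
    exact ((hg'.integrableOn_Ioc).indicator hm).const_mul _
  calc ∫ x in S, g' x = ∫ x in Ioc a b, S.indicator 1 x * g' x := by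
        simp_rw [← indicator_mul_left, Pi.one_apply, one_mul]
        rw [setIntegral_indicator hS.measurableSet, inter_eq_self_of_subset_right hab]
    _ = ∑ i, s i * ∫ x in Ioc a b, (endpointRay (s i) (t i)).indicator 1 x * g' x := by
        simp_rw [hind, Finset.sum_mul, mul_assoc]
        rw [integral_finsetSum _ fun i _ => hint i]
        simp_rw [integral_const_mul]
    _ = ∑ i, s i * (g (t i) - g a) := by
        simp_rw [setIntegral_Ioc_endpointRay (htab _).1.le (htab _).2 hg hg']
    _ = ∑ i, s i * g (t i) := by
        simp_rw [mul_sub]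
        rw [Finset.sum_sub_distrib, ← Finset.sum_mul, hsum, zero_mul, sub_zero]

end Line

theorem integrable_tsum_of_summable_integral_norm {Ω F : Type*} [MeasurableSpace Ω]
    {μ : Measure Ω} [NormedAddCommGroup F] [CompleteSpace F] {g : ℕ → Ω → F}
    (hg : ∀ m, Integrable (g m) μ) (hsumm : Summable fun m => ∫ y, ‖g m y‖ ∂μ) :
    Integrable (fun y => ∑' m, g m y) μ := by
  have hlint : ∫⁻ y, ∑' m, ‖g m y‖ₑ ∂μ < ⊤ := by
    rw [lintegral_tsum fun m => (hg m).1.enorm]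
    simp_rw [← fun m => ofReal_integral_norm_eq_lintegral_enorm (hg m)]
    rw [← ENNReal.ofReal_tsum_of_nonneg (fun m => integral_nonneg fun y => norm_nonneg _) hsumm]
    exact ENNReal.ofReal_lt_top
  have hae : ∀ᵐ y ∂μ, Summable fun m => g m y := by
    filter_upwards [ae_lt_top' (.tsum fun m => (hg m).1.enorm) hlint.ne] with y hy
    exact (tsum_enorm_ne_top_iff_summable_norm.1 hy.ne).of_norm
  refine ⟨aestronglyMeasurable_of_tendsto_ae Filter.atTop
    (f := fun N y => ∑ m ∈ Finset.range N, g m y)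
    (fun N => Finset.aestronglyMeasurable_fun_sum _ fun m _ => (hg m).1) ?_, ?_⟩
  · filter_upwards [hae] with y hy using hy.hasSum.tendsto_sum_nat
  · exact (lintegral_mono fun y => enorm_tsum_le_tsum_enorm).trans_lt hlint

section AreaFormula

section FiberSum

variable {X Y F : Type*} [AddCommGroup F] [TopologicalSpace F]

/-- The sum of `c` over the points of `s` that `f` maps to `y`, with the junk value `0` if the sum
diverges. -/
noncomputable def fiberSum (f : X → Y) (c : X → F) (s : Set X) (y : Y) : F :=
  ∑' x : ↥(s ∩ f ⁻¹' {y}), c x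

variable {f : X → Y} {c : X → F} {s : Set X}

theorem fiberSum_eq_zero {y : Y} (hy : y ∉ f '' s) : fiberSum f c s y = 0 := by
  have : IsEmpty ↥(s ∩ f ⁻¹' {y}) := ⟨fun x => hy ⟨x, x.2⟩⟩
  exact tsum_empty

theorem fiberSum_apply_of_injOn (hf : InjOn f s) {x : X} (hx : x ∈ s) :
    fiberSum f c s (f x) = c x := by
  let x' : ↥(s ∩ f ⁻¹' {f x}) := ⟨x, hx, rfl⟩
  exact tsum_eq_single x' fun z hz =>
    absurd (Subtype.ext (hf z.2.1 hx (show f z = f x from z.2.2))) hz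

theorem fiberSum_iUnion_of_injOn [T2Space F] {p : ℕ → Set X}
    (hp : Pairwise (Function.onFun Disjoint p)) (hf : ∀ m, InjOn f (p m)) (y : Y) :
    fiberSum f c (⋃ m, p m) y = ∑' m, fiberSum f c (p m) y := by
  choose m hm using fun x : ↥((⋃ m, p m) ∩ f ⁻¹' {y}) => mem_iUnion.1 x.2.1
  have hm_inj : Function.Injective m := fun x z h =>
    Subtype.ext (hf (m x) (hm x) (h ▸ hm z) (x.2.2.trans z.2.2.symm))
  have hsupp : (Function.support fun m => fiberSum f c (p m) y) ⊆ range m := by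
    intro l hl
    by_contra hl'
    refine hl (fiberSum_eq_zero ?_)
    rintro ⟨x, hx, rfl⟩
    refine hl' ⟨⟨x, mem_iUnion.2 ⟨l, hx⟩, rfl⟩, ?_⟩
    by_contra hne
    exact disjoint_left.1 (hp hne) (hm _) hx
  rw [← hm_inj.tsum_eq hsupp]
  refine tsum_congr fun x => ?_
  exact ((congrArg _ (mem_singleton_iff.1 x.2.2).symm).trans
    (fiberSum_apply_of_injOn (hf _) (hm x))).symm

end FiberSum

variable {E F : Type*} [NormedAddCommGroup E] [NormedSpace ℝ E] [NormedAddCommGroup F]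
  {f : E → E} {f' : E → E →L[ℝ] E} {c : E → F} {s : Set E}

/-- A map with invertible derivative is locally injective in a quantitative sense, and `E` is
second countable. -/
theorem exists_measurable_partition_injOn [FiniteDimensional ℝ E] [MeasurableSpace E]
    [BorelSpace E] (hs : MeasurableSet s) (hf' : ∀ x ∈ s, HasFDerivWithinAt f (f' x) s x)
    (hdet : ∀ x ∈ s, (f' x).det ≠ 0) :
    ∃ p : ℕ → Set E, Pairwise (Function.onFun Disjoint p) ∧ (∀ m, MeasurableSet (p m)) ∧
      ⋃ m, p m = s ∧ ∀ m, InjOn f (p m) := by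
  have hr : ∀ A : E →L[ℝ] E, ∃ r : ℝ≥0, r ≠ 0 ∧ (A.det ≠ 0 → ∀ t : Set E,
      ApproximatesLinearOn f A t r → InjOn f t) := by
    intro A
    by_cases hA : A.det = 0
    · exact ⟨1, one_ne_zero, fun h => absurd hA h⟩
    rcases subsingleton_or_nontrivial E with hE | hE
    · exact ⟨1, one_ne_zero, fun _ t _ => injOn_of_subsingleton f t⟩
    let B := A.toContinuousLinearEquivOfDetNeZero hA
    have hpos : 0 < ‖(B.symm : E →L[ℝ] E)‖₊⁻¹ := inv_pos.2 B.norm_symm_pos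
    refine ⟨‖(B.symm : E →L[ℝ] E)‖₊⁻¹ / 2, (half_pos hpos).ne', fun _ t ht => ?_⟩
    have hAB : A = (B : E →L[ℝ] E) := by ext; simp [B]
    rw [hAB] at ht
    exact ht.injOn (Or.inr (half_lt_self hpos))
  choose r hr0 hr using hr
  rcases s.eq_empty_or_nonempty with rfl | hne
  · exact ⟨fun _ => ∅, fun _ _ _ => disjoint_bot_left, fun _ => .empty, iUnion_empty,
      fun _ => injOn_empty f⟩
  obtain ⟨t, A, ht_disj, ht_meas, hst, happrox, hA⟩ :=
    exists_partition_approximatesLinearOn_of_hasFDerivWithinAt f s f' hf' r hr0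
  refine ⟨fun m => s ∩ t m, fun l m h => (ht_disj h).mono inter_subset_right inter_subset_right,
    fun m => hs.inter (ht_meas m), by rw [← inter_iUnion, inter_eq_left.2 hst], fun m => ?_⟩
  obtain ⟨y, hy, hAy⟩ := hA hne m
  exact hr (A m) (hAy ▸ hdet y hy) _ (happrox m)

variable [FiniteDimensional ℝ E] [MeasurableSpace E] [BorelSpace E] (μ : Measure E)
  [μ.IsAddHaarMeasure] [NormedSpace ℝ F]

theorem integrable_fiberSum_of_injOn (hs : MeasurableSet s)
    (hf' : ∀ x ∈ s, HasFDerivWithinAt f (f' x) s x) (hf : InjOn f s)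
    (hc : IntegrableOn (fun x => |(f' x).det| • c x) s μ) : Integrable (fiberSum f c s) μ := by
  refine (integrableOn_iff_integrable_of_support_subset fun y hy => ?_).1
    ((integrableOn_image_iff_integrableOn_abs_det_fderiv_smul μ hs hf' hf _).2 ?_)
  · by_contra h
    exact hy (fiberSum_eq_zero h)
  · exact hc.congr_fun (fun x hx => by simp only [fiberSum_apply_of_injOn hf hx]) hs

theorem integral_fiberSum_of_injOn (hs : MeasurableSet s)
    (hf' : ∀ x ∈ s, HasFDerivWithinAt f (f' x) s x) (hf : InjOn f s) :
    ∫ y, fiberSum f c s y ∂μ = ∫ x in s, |(f' x).det| • c x ∂μ := by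
  rw [← setIntegral_eq_integral_of_forall_compl_eq_zero fun y => fiberSum_eq_zero (s := s) (c := c),
    integral_image_eq_integral_abs_det_fderiv_smul μ hs hf' hf]
  exact setIntegral_congr_fun hs fun x hx => by simp only [fiberSum_apply_of_injOn hf hx]

theorem integral_norm_fiberSum_of_injOn (hs : MeasurableSet s)
    (hf' : ∀ x ∈ s, HasFDerivWithinAt f (f' x) s x) (hf : InjOn f s) :
    ∫ y, ‖fiberSum f c s y‖ ∂μ = ∫ x in s, ‖|(f' x).det| • c x‖ ∂μ := by
  have hnorm : ∀ y, ‖fiberSum f c s y‖ = fiberSum f (fun x => ‖c x‖) s y := fun y => by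
    by_cases hy : y ∈ f '' s
    · obtain ⟨x, hx, rfl⟩ := hy
      simp only [fiberSum_apply_of_injOn hf hx]
    · simp only [fiberSum_eq_zero hy, norm_zero]
  simp only [hnorm, integral_fiberSum_of_injOn μ hs hf' hf, norm_smul, Real.norm_eq_abs, abs_abs,
    smul_eq_mul]

theorem integrable_fiberSum_and_integral_eq [CompleteSpace F] (hs : MeasurableSet s)
    (hf' : ∀ x ∈ s, HasFDerivWithinAt f (f' x) s x) (hdet : ∀ x ∈ s, (f' x).det ≠ 0)
    (hc : IntegrableOn (fun x => |(f' x).det| • c x) s μ) :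
    Integrable (fiberSum f c s) μ ∧
      ∫ y, fiberSum f c s y ∂μ = ∫ x in s, |(f' x).det| • c x ∂μ := by
  obtain ⟨p, hp_disj, hp_meas, hps, hp_inj⟩ := exists_measurable_partition_injOn hs hf' hdet
  have hsub : ∀ m, p m ⊆ s := fun m => hps ▸ subset_iUnion p m
  have hpf' : ∀ m, ∀ x ∈ p m, HasFDerivWithinAt f (f' x) (p m) x := fun m x hx =>
    (hf' x (hsub m hx)).mono (hsub m)
  have hint : ∀ m, Integrable (fiberSum f c (p m)) μ := fun m =>
    integrable_fiberSum_of_injOn μ (hp_meas m) (hpf' m) (hp_inj m) (hc.mono_set (hsub m))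
  have hsumm : Summable fun m => ∫ y, ‖fiberSum f c (p m) y‖ ∂μ := by
    simp_rw [fun m => integral_norm_fiberSum_of_injOn (c := c) μ (hp_meas m) (hpf' m) (hp_inj m)]
    exact (hasSum_integral_iUnion hp_meas hp_disj (hps.symm ▸ hc.norm)).summable
  have hsplit : fiberSum f c s = fun y => ∑' m, fiberSum f c (p m) y := by
    ext1 y
    rw [← fiberSum_iUnion_of_injOn hp_disj hp_inj, hps]
  refine ⟨?_, ?_⟩
  · exact hsplit ▸ integrable_tsum_of_summable_integral_norm hint hsumm
  · rw [hsplit, ← (hasSum_integral_of_summable_integral_norm hint hsumm).tsum_eq, ← hps,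
      integral_iUnion hp_meas hp_disj (hps.symm ▸ hc)]
    exact tsum_congr fun m => integral_fiberSum_of_injOn μ (hp_meas m) (hpf' m) (hp_inj m)

end AreaFormula

section UnitCube

variable {k : ℕ}

theorem isCompact_unitCube : IsCompact (unitCube k) := isCompact_Icc

theorem convex_unitCube : Convex ℝ (unitCube k) := convex_Icc 0 1

theorem interior_unitCube_nonempty : (interior (unitCube k)).Nonempty := by
  rw [unitCube, ← pi_univ_Icc, interior_pi_set finite_univ]
  simp [univ_pi_nonempty_iff]

theorem uniqueDiffOn_unitCube : UniqueDiffOn ℝ (unitCube k) :=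
  uniqueDiffOn_convex convex_unitCube interior_unitCube_nonempty

theorem volume_unitCube_diff_interior :
    volume (unitCube k \ interior (unitCube k)) = 0 := by
  rw [← isCompact_unitCube.isClosed.frontier_eq]
  exact convex_unitCube.addHaar_frontier volume

theorem interior_unitCube_ae_eq : interior (unitCube k) =ᵐ[volume] unitCube k :=
  interior_ae_eq_of_null_frontier (convex_unitCube.addHaar_frontier volume)

end UnitCube

section DetCons

variable {k : ℕ}

/-- The linear form `x ↦ det (x, w₀, …, w_{k-1})` in the orientation convention of `DiskDomain`. -/
noncomputable def detCons (w : Fin k → Fin (k + 1) → ℝ) : (Fin (k + 1) → ℝ) →L[ℝ] ℝ :=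
  LinearMap.toContinuousLinearMap
    { toFun := fun x => (Matrix.detRowAlternating (R := ℝ) (n := Fin (k + 1))).curryLeft x w
      map_add' := fun x y => by simp only [map_add, AlternatingMap.add_apply]
      map_smul' := fun c x => by simp }

theorem detCons_apply (w : Fin k → Fin (k + 1) → ℝ) (x : Fin (k + 1) → ℝ) :
    detCons w x = Matrix.det (Matrix.of (Fin.cons x w)) := rfl

theorem detCons_self (w : Fin k → Fin (k + 1) → ℝ) (i : Fin k) : detCons w (w i) = 0 := by
  rw [detCons_apply]
  exact Matrix.det_zero_of_row_eq (i := 0) (j := i.succ) (Fin.succ_ne_zero i).symm (by ext; simp)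

theorem detCons_map (A : (Fin k → ℝ) →L[ℝ] Fin (k + 1) → ℝ) (h : Fin k → ℝ) :
    detCons (fun i => A (Pi.single i 1)) (A h) = 0 := by
  rw [pi_eq_sum_univ' h, map_sum, map_sum]
  simp only [map_smul, detCons_self (fun i => A (Pi.single i 1)), smul_zero, Finset.sum_const_zero]

theorem injective_of_detCons_ne_zero {A : (Fin k → ℝ) →L[ℝ] Fin (k + 1) → ℝ}
    {x : Fin (k + 1) → ℝ} (hx : detCons (fun i => A (Pi.single i 1)) x ≠ 0) :
    Function.Injective A := by
  have hli : LinearIndependent ℝ fun i => A (Pi.single i 1) :=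
    (Matrix.linearIndependent_rows_of_det_ne_zero hx).comp Fin.succ (Fin.succ_injective k)
  rw [injective_iff_map_eq_zero]
  intro h hh
  rw [pi_eq_sum_univ' h, map_sum] at hh
  simp only [map_smul] at hh
  exact funext (Fintype.linearIndependent_iff.1 hli h hh)

end DetCons

theorem subset_interior_of_disjoint_frontier {X : Type*} [TopologicalSpace X] {s t : Set X}
    (ht : IsPreconnected t) (hfr : Disjoint t (frontier s)) (hne : (t ∩ interior s).Nonempty) :
    t ⊆ interior s := by
  refine ht.subset_left_of_subset_union isOpen_interior isClosed_closure.isOpen_compl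
    (disjoint_compl_right_iff_subset.2 interior_subset_closure) (fun x hx => ?_) hne
  by_contra h
  rw [mem_union, not_or, mem_compl_iff, not_not] at h
  exact disjoint_left.1 hfr hx ⟨h.2, h.1⟩

/-- The image of an immersion leaves a cone over any compact set of directions that are transversal
to its tangent space. -/
theorem exists_mem_nhds_forall_add_smul_notMem_image {E F : Type*} [NormedAddCommGroup E]
    [NormedSpace ℝ E] [NormedAddCommGroup F] [NormedSpace ℝ F] {g : E → F}
    {A : E →L[ℝ] F} {u : E} (hg : HasFDerivAt g A u) (hA : Topology.IsClosedEmbedding A)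
    {K : Set F} (hK : IsCompact K) (hKA : Disjoint K (range A)) :
    ∃ V ∈ 𝓝 u, ∀ t : ℝ, t ≠ 0 → ∀ x ∈ K, g u + t • x ∉ g '' V := by
  obtain ⟨c, hc, hKc⟩ := hK.exists_thickening_subset_open
    hA.isClosed_range.isOpen_compl hKA.subset_compl_right
  obtain ⟨R, hR, hKR⟩ := hK.isBounded.exists_pos_norm_le
  have ho : (fun u' => g u' - g u - A (u' - u)) =o[𝓝 u] fun u' => g u' - g u :=
    hg.isLittleO.trans_isBigO (hg.isTheta_sub hA.isInducing).isBigO_symm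
  refine ⟨_, ho.def (div_pos hc (mul_pos two_pos hR)), fun t ht x hx => ?_⟩
  rintro ⟨u', hu', hgu'⟩
  simp only [mem_ofPred_eq, hgu', add_sub_cancel_left, norm_smul] at hu'
  have hdist : dist (A (t⁻¹ • (u' - u))) x < c := by
    rw [dist_comm, dist_eq_norm]
    have h : ‖x - A (t⁻¹ • (u' - u))‖ ≤ c / (2 * R) * ‖x‖ := by
      refine le_of_mul_le_mul_left ?_ (norm_pos_iff.2 ht)
      rw [← norm_smul, smul_sub, ← map_smul, smul_inv_smul₀ ht]
      linarith
    calc ‖x - A (t⁻¹ • (u' - u))‖ ≤ c / (2 * R) * R := h.trans (by gcongr; exact hKR x hx)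
      _ = c / 2 := by field_simp
      _ < c := half_lt_self hc
  exact hKc (Metric.mem_thickening_iff.2 ⟨x, hx, hdist⟩) (mem_range_self _)

namespace DiskDomain

variable {k : ℕ} (B : DiskDomain k)

theorem isCompact_carrier : IsCompact B.carrier := by
  obtain ⟨e⟩ := B.homeo_ball
  have : CompactSpace (Metric.closedBall (0 : EuclideanSpace ℝ (Fin (k + 1))) 1) :=
    isCompact_iff_compactSpace.1 (isCompact_closedBall 0 1)
  exact isCompact_iff_compactSpace.2 e.symm.compactSpace

/-- The derivative of a boundary piece. -/
noncomputable abbrev pieceDeriv (j : Fin B.numPieces) (u : Fin k → ℝ) :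
    (Fin k → ℝ) →L[ℝ] Fin (k + 1) → ℝ :=
  fderivWithin ℝ (B.piece j) (unitCube k) u

/-- The coordinate vectors `∂ψ_j/∂u_i` of a boundary piece. -/
noncomputable abbrev pieceVec (j : Fin B.numPieces) (u : Fin k → ℝ) (i : Fin k) :
    Fin (k + 1) → ℝ :=
  B.pieceDeriv j u (Pi.single i 1)

theorem hasFDerivWithinAt_piece (j : Fin B.numPieces) {u : Fin k → ℝ} (hu : u ∈ unitCube k) :
    HasFDerivWithinAt (B.piece j) (B.pieceDeriv j u) (unitCube k) u :=
  ((B.contDiffOn_piece j).differentiableOn one_ne_zero u hu).hasFDerivWithinAt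

theorem hasFDerivAt_piece (j : Fin B.numPieces) {u : Fin k → ℝ}
    (hu : u ∈ interior (unitCube k)) : HasFDerivAt (B.piece j) (B.pieceDeriv j u) u :=
  (B.hasFDerivWithinAt_piece j (interior_subset hu)).hasFDerivAt (mem_interior_iff_mem_nhds.1 hu)

theorem continuousOn_piece (j : Fin B.numPieces) : ContinuousOn (B.piece j) (unitCube k) :=
  (B.contDiffOn_piece j).continuousOn

theorem continuousOn_pieceDeriv (j : Fin B.numPieces) :
    ContinuousOn (B.pieceDeriv j) (unitCube k) :=
  (B.contDiffOn_piece j).continuousOn_fderivWithin uniqueDiffOn_unitCube le_rfl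

theorem continuousOn_pieceVec (j : Fin B.numPieces) (i : Fin k) :
    ContinuousOn (fun u => B.pieceVec j u i) (unitCube k) :=
  (B.continuousOn_pieceDeriv j).clm_apply continuousOn_const

theorem piece_mem_frontier (j : Fin B.numPieces) {u : Fin k → ℝ} (hu : u ∈ unitCube k) :
    B.piece j u ∈ frontier B.carrier := by
  rw [B.frontier_eq]
  exact mem_iUnion.2 ⟨j, mem_image_of_mem _ hu⟩

theorem piece_mem_carrier (j : Fin B.numPieces) {u : Fin k → ℝ} (hu : u ∈ unitCube k) :
    B.piece j u ∈ B.carrier :=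
  B.isCompact_carrier.isClosed.frontier_subset (B.piece_mem_frontier j hu)

/-- The part of the boundary where pieces may meet or degenerate: the images of the boundary of the
cube. -/
def edges : Set (Fin (k + 1) → ℝ) :=
  ⋃ j, B.piece j '' (unitCube k \ interior (unitCube k))

variable {B} in
theorem mem_interior_unitCube_of_notMem_edges {j : Fin B.numPieces} {u : Fin k → ℝ}
    (hu : u ∈ unitCube k) (hp : B.piece j u ∉ B.edges) : u ∈ interior (unitCube k) := by
  by_contra h
  exact hp (mem_iUnion.2 ⟨j, u, ⟨hu, h⟩, rfl⟩)

variable {B} in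
theorem piece_eq_piece_iff_of_notMem_edges {i j : Fin B.numPieces} {u u' : Fin k → ℝ}
    (hu : u ∈ unitCube k) (hu' : u' ∈ unitCube k) (hp : B.piece j u ∉ B.edges) :
    B.piece i u' = B.piece j u ↔ i = j ∧ u' = u := by
  refine ⟨fun h => ?_, by rintro ⟨rfl, rfl⟩; rfl⟩
  have hi := mem_interior_unitCube_of_notMem_edges hu hp
  have hi' := mem_interior_unitCube_of_notMem_edges hu' (h ▸ hp)
  have hij : i = j := by
    by_contra hij
    exact disjoint_left.1 (B.disjoint_pieces i j hij) ⟨u', hi', h⟩ ⟨u, hi, rfl⟩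
  subst hij
  exact ⟨rfl, B.injOn_piece i hi' hi h⟩

theorem eventually_frontier_mem_image_piece {j : Fin B.numPieces} {u : Fin k → ℝ}
    (hu : u ∈ unitCube k) (hp : B.piece j u ∉ B.edges) {V : Set (Fin k → ℝ)}
    (hV : V ∈ 𝓝 u) :
    ∀ᶠ x in 𝓝 (B.piece j u), x ∈ frontier B.carrier → x ∈ B.piece j '' V := by
  -- The rest of the boundary is compact and does not contain the point.
  let K : Fin B.numPieces → Set (Fin k → ℝ) := fun i => {u' ∈ unitCube k | i = j → u' ∉ interior V}
  have hK : ∀ i, IsCompact (K i) := fun i => by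
    by_cases hij : i = j
    · simp only [K, hij, true_imp_iff]
      exact isCompact_unitCube.diff isOpen_interior
    · simpa [K, hij] using isCompact_unitCube
  have hclosed : IsClosed (⋃ i, B.piece i '' K i) :=
    isClosed_iUnion_of_finite fun i =>
      ((hK i).image_of_continuousOn ((B.continuousOn_piece i).mono fun _ h => h.1)).isClosed
  have hnot : B.piece j u ∉ ⋃ i, B.piece i '' K i := fun h => by
    obtain ⟨i, u', hu', h⟩ := mem_iUnion.1 h
    obtain ⟨rfl, rfl⟩ := (piece_eq_piece_iff_of_notMem_edges hu hu'.1 hp).1 h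
    exact hu'.2 rfl (mem_interior_iff_mem_nhds.2 hV)
  filter_upwards [hclosed.isOpen_compl.mem_nhds hnot] with x hx hxf
  rw [B.frontier_eq] at hxf
  obtain ⟨i, u', hu', rfl⟩ := mem_iUnion.1 hxf
  by_contra h
  refine hx (mem_iUnion.2 ⟨i, u', ⟨hu', ?_⟩, rfl⟩)
  rintro rfl hV'
  exact h (mem_image_of_mem _ (interior_subset hV'))

theorem eventually_forall_segment_notMem_frontier {j : Fin B.numPieces} {u : Fin k → ℝ}
    (hu : u ∈ unitCube k) (hp : B.piece j u ∉ B.edges) {v w : Fin (k + 1) → ℝ}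
    (hv : 0 < detCons (B.pieceVec j u) v) (hw : 0 < detCons (B.pieceVec j u) w) :
    ∀ᶠ t : ℝ in 𝓝[≠] 0, ∀ x ∈ segment ℝ v w, B.piece j u + t • x ∉ frontier B.carrier := by
  have hcompact : IsCompact (segment ℝ v w) := by
    rw [segment_eq_image_lineMap]
    exact isCompact_Icc.image (by fun_prop)
  have htransversal : Disjoint (segment ℝ v w) (range (B.pieceDeriv j u)) := by
    rw [disjoint_right]
    rintro _ ⟨h, rfl⟩ hseg
    have hpos : B.pieceDeriv j u h ∈ {x | 0 < detCons (B.pieceVec j u) x} :=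
      (convex_halfSpace_gt (detCons (B.pieceVec j u)).isLinear 0).segment_subset hv hw hseg
    exact (mem_ofPred_eq ▸ hpos).ne' (detCons_map _ _)
  have hclosed : Topology.IsClosedEmbedding (B.pieceDeriv j u) :=
    LinearMap.isClosedEmbedding_of_injective
      (LinearMap.ker_eq_bot.2 (injective_of_detCons_ne_zero hv.ne'))
  obtain ⟨V, hV, hVnot⟩ := exists_mem_nhds_forall_add_smul_notMem_image
    (B.hasFDerivAt_piece j (mem_interior_unitCube_of_notMem_edges hu hp)) hclosed hcompact
    htransversal
  have hnear : ∀ᶠ t : ℝ in 𝓝 0, ∀ x ∈ segment ℝ v w,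
      B.piece j u + t • x ∈ frontier B.carrier → B.piece j u + t • x ∈ B.piece j '' V := by
    refine hcompact.eventually_forall_of_forall_eventually fun x _ => ?_
    have hcont : Filter.Tendsto (fun z : ℝ × (Fin (k + 1) → ℝ) => B.piece j u + z.1 • z.2)
        (𝓝 (0, x)) (𝓝 (B.piece j u)) :=
      Continuous.tendsto' (by fun_prop) _ _ (by simp)
    exact hcont.eventually (B.eventually_frontier_mem_image_piece hu hp hV)
  filter_upwards [hnear.filter_mono nhdsWithin_le_nhds, self_mem_nhdsWithin] with t ht ht0 x hx hfr
  exact hVnot t ht0 x hx (ht x hx hfr)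

theorem pointsOutward_of_detCons_pos {j : Fin B.numPieces} {u : Fin k → ℝ}
    (hu : u ∈ unitCube k) (hp : B.piece j u ∉ B.edges) {w : Fin (k + 1) → ℝ}
    (hw : 0 < detCons (B.pieceVec j u) w) : PointsOutward B.carrier (B.piece j u) w := by
  obtain ⟨ν, hν, hdet⟩ := B.oriented j u (mem_interior_unitCube_of_notMem_edges hu hp)
  -- Turning `ν` into `w` along the segment between them, one stays off the boundary.
  have hturn : ∀ (S : Set (Fin (k + 1) → ℝ)) (t : ℝ), frontier S = frontier B.carrier →
      (∀ x ∈ segment ℝ ν w, B.piece j u + t • x ∉ frontier B.carrier) →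
        B.piece j u + t • ν ∈ interior S → B.piece j u + t • w ∈ interior S := by
    intro S t hS ht hmem
    have hpre : IsPreconnected ((fun x => B.piece j u + t • x) '' segment ℝ ν w) :=
      (convex_segment ν w).isPreconnected.image _ (by fun_prop)
    refine subset_interior_of_disjoint_frontier hpre ?_
      ⟨_, mem_image_of_mem _ (left_mem_segment ℝ ν w), hmem⟩
      (mem_image_of_mem _ (right_mem_segment ℝ ν w))
    rw [hS, disjoint_left]
    rintro _ ⟨x, hx, rfl⟩
    exact ht x hx
  have hoff := B.eventually_forall_segment_notMem_frontier hu hp (v := ν) hdet hw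
  have hneg : Filter.Tendsto (fun t : ℝ => -t) (𝓝[>] 0) (𝓝[≠] 0) := by
    simpa using (tendsto_neg_nhdsGT (a := (0 : ℝ))).mono_right (nhdsLT_le_nhdsNE _)
  filter_upwards [hν, hoff.filter_mono (nhdsGT_le_nhdsNE 0), hneg.eventually hoff]
    with t ht hpos hneg
  have hcompl : interior B.carrierᶜ = B.carrierᶜ :=
    B.isCompact_carrier.isClosed.isOpen_compl.interior_eq
  rw [sub_eq_add_neg, ← neg_smul] at ht ⊢
  refine ⟨?_, hturn B.carrier (-t) rfl hneg ht.2⟩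
  have := hturn B.carrierᶜ t (frontier_compl _) hpos
  rw [hcompl] at this
  exact this ht.1

end DiskDomain

section CoordinateLine

variable {k : ℕ}

/-- The projection of `ℝ^(k+1)` along the `i`-th axis. -/
noncomputable def removeCoord (i : Fin (k + 1)) : (Fin (k + 1) → ℝ) →L[ℝ] Fin k → ℝ :=
  ContinuousLinearMap.pi fun l => ContinuousLinearMap.proj (i.succAbove l)

theorem removeCoord_apply (i : Fin (k + 1)) (x : Fin (k + 1) → ℝ) (l : Fin k) :
    removeCoord i x l = x (i.succAbove l) := rfl

/-- The line over `y` parallel to the `i`-th axis. -/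
def coordLine (i : Fin (k + 1)) (y : Fin k → ℝ) (t : ℝ) : Fin (k + 1) → ℝ :=
  i.insertNth (α := fun _ => ℝ) t y

variable (i : Fin (k + 1)) (y : Fin k → ℝ)

theorem coordLine_add (t τ : ℝ) :
    coordLine i y (t + τ) = coordLine i y t + τ • Pi.single i 1 := by
  ext l
  refine Fin.succAboveCases i ?_ (fun l => ?_) l <;> simp [coordLine]

theorem coordLine_apply_self (t : ℝ) : coordLine i y t i = t := by simp [coordLine]

theorem removeCoord_coordLine (t : ℝ) : removeCoord i (coordLine i y t) = y := by
  ext l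
  simp [removeCoord_apply, coordLine]

theorem coordLine_removeCoord (x : Fin (k + 1) → ℝ) :
    coordLine i (removeCoord i x) (x i) = x := by
  ext l
  refine Fin.succAboveCases i ?_ (fun l => ?_) l <;> simp [removeCoord_apply, coordLine]

theorem hasDerivAt_coordLine (t : ℝ) : HasDerivAt (coordLine i y) (Pi.single i 1) t := by
  have h : coordLine i y = fun τ => coordLine i y 0 + τ • Pi.single i 1 := by
    ext1 τ
    rw [← coordLine_add, zero_add]
  rw [h]
  simpa using ((hasDerivAt_id t).smul_const (Pi.single i (1 : ℝ))).const_add (coordLine i y 0)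

theorem continuous_coordLine : Continuous (coordLine i y) :=
  continuous_iff_continuousAt.2 fun t => (hasDerivAt_coordLine i y t).continuousAt

theorem isCompact_preimage_coordLine {S : Set (Fin (k + 1) → ℝ)} (hS : IsCompact S) :
    IsCompact (coordLine i y ⁻¹' S) :=
  (hS.image (continuous_apply i)).of_isClosed_subset
    (hS.isClosed.preimage (continuous_coordLine i y))
    fun t ht => ⟨coordLine i y t, ht, coordLine_apply_self i y t⟩

theorem integral_eq_integral_integral_coordLine {F : Type*} [NormedAddCommGroup F]
    [NormedSpace ℝ F] {g : (Fin (k + 1) → ℝ) → F} (hg : Integrable g) :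
    ∫ x, g x = ∫ y, ∫ t, g (coordLine i y t) := by
  have hmp := (volume_preserving_piFinSuccAbove (fun _ : Fin (k + 1) => ℝ) i).symm
  rw [← hmp.integral_comp', Measure.volume_eq_prod, integral_prod_symm]
  · rfl
  · rw [← Measure.volume_eq_prod]
    exact (hmp.integrable_comp_emb (MeasurableEquiv.measurableEmbedding _)).2 hg

variable {i} in
theorem detCons_single (w : Fin k → Fin (k + 1) → ℝ) :
    detCons w (Pi.single i 1) =
      (-1) ^ (i : ℕ) * Matrix.det (Matrix.of fun a => removeCoord i (w a)) := by
  rw [detCons_apply, Matrix.det_succ_row_zero, Finset.sum_eq_single i]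
  · simp only [Matrix.of_apply, Fin.cons_zero, Pi.single_eq_same, mul_one]
    rfl
  · intro l _ hl
    simp [Pi.single_eq_of_ne hl]
  · simp

end CoordinateLine

namespace DiskDomain

variable {k : ℕ} (B : DiskDomain k)

section RegularPoints

variable (i : Fin (k + 1)) (j : Fin B.numPieces)

/-- The derivative of a boundary piece followed by the projection along the `i`-th axis. -/
noncomputable abbrev projDeriv (u : Fin k → ℝ) : (Fin k → ℝ) →L[ℝ] Fin k → ℝ :=
  (removeCoord i).comp (B.pieceDeriv j u)

theorem abs_det_projDeriv (u : Fin k → ℝ) :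
    |(B.projDeriv i j u).det| = |detCons (B.pieceVec j u) (Pi.single i 1)| := by
  have h : (B.projDeriv i j u).det =
      Matrix.det (Matrix.of fun a => removeCoord i (B.pieceVec j u a)) := by
    rw [ContinuousLinearMap.det, ← LinearMap.det_toMatrix', ← Matrix.det_transpose]
    rfl
  rw [detCons_single, abs_mul, abs_neg_one_pow, one_mul, h]

/-- The points in the interior of a piece that are regular for the projection along the `i`-th
axis. -/
def regularPoints : Set (Fin k → ℝ) :=
  {u | u ∈ interior (unitCube k) ∧ (B.projDeriv i j u).det ≠ 0}

/-- The values of the projection along the `i`-th axis that are critical or hit by the edges. -/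
def criticalValues : Set (Fin k → ℝ) :=
  ⋃ j, (removeCoord i ∘ B.piece j) '' (unitCube k \ B.regularPoints i j)

/-- The regular points of a piece on the line over `y` parallel to the `i`-th axis. -/
def regularFiber (y : Fin k → ℝ) (j : Fin B.numPieces) : Set (Fin k → ℝ) :=
  B.regularPoints i j ∩ (removeCoord i ∘ B.piece j) ⁻¹' {y}

theorem regularPoints_subset_unitCube : B.regularPoints i j ⊆ unitCube k :=
  fun _ hu => interior_subset hu.1

theorem hasFDerivWithinAt_removeCoord_piece {u : Fin k → ℝ} (hu : u ∈ unitCube k) :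
    HasFDerivWithinAt (removeCoord i ∘ B.piece j) (B.projDeriv i j u) (unitCube k) u :=
  (removeCoord i).hasFDerivAt.comp_hasFDerivWithinAt u (B.hasFDerivWithinAt_piece j hu)

theorem volume_criticalValues : volume (B.criticalValues i) = 0 := by
  refine measure_iUnion_null fun j => ?_
  have hd : ∀ s ⊆ unitCube k, ∀ u ∈ s,
      HasFDerivWithinAt (removeCoord i ∘ B.piece j) (B.projDeriv i j u) s u := fun s hs u hu =>
    (B.hasFDerivWithinAt_removeCoord_piece i j (hs hu)).mono hs
  have hsplit : unitCube k \ B.regularPoints i j ⊆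
      (unitCube k \ interior (unitCube k)) ∪ {u ∈ unitCube k | (B.projDeriv i j u).det = 0} := by
    rintro u ⟨hu, hreg⟩
    by_cases hi : u ∈ interior (unitCube k)
    · exact Or.inr ⟨hu, by_contra fun h => hreg ⟨hi, h⟩⟩
    · exact Or.inl ⟨hu, hi⟩
  refine measure_mono_null (image_mono hsplit) ?_
  rw [image_union]
  refine measure_union_null ?_ ?_
  · exact addHaar_image_eq_zero_of_differentiableOn_of_addHaar_eq_zero volume
      (fun u hu => (hd _ sdiff_subset u hu).differentiableWithinAt) volume_unitCube_diff_interior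
  · exact addHaar_image_eq_zero_of_det_fderivWithin_eq_zero volume
      (hd _ (sep_subset _ _)) fun u hu => hu.2

theorem continuousOn_det_projDeriv :
    ContinuousOn (fun u => (B.projDeriv i j u).det) (unitCube k) :=
  ContinuousLinearMap.continuous_det.comp_continuousOn
    (continuousOn_const.clm_comp (B.continuousOn_pieceDeriv j))

theorem isOpen_regularPoints : IsOpen (B.regularPoints i j) :=
  ((B.continuousOn_det_projDeriv i j).mono interior_subset).isOpen_inter_preimage isOpen_interior
    isOpen_ne

variable {B i j}

theorem mem_regularPoints_of_notMem_criticalValues {u : Fin k → ℝ} (hu : u ∈ unitCube k)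
    (hy : removeCoord i (B.piece j u) ∉ B.criticalValues i) : u ∈ B.regularPoints i j :=
  by_contra fun h => hy (mem_iUnion.2 ⟨j, u, ⟨hu, h⟩, rfl⟩)

theorem notMem_edges_of_notMem_criticalValues {x : Fin (k + 1) → ℝ}
    (hx : removeCoord i x ∉ B.criticalValues i) : x ∉ B.edges := by
  intro h
  obtain ⟨j, u, hu, rfl⟩ := mem_iUnion.1 h
  exact hu.2 (mem_regularPoints_of_notMem_criticalValues hu.1 hx).1

theorem finite_regularFiber {y : Fin k → ℝ} (hy : y ∉ B.criticalValues i)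
    (j : Fin B.numPieces) : (B.regularFiber i y j).Finite := by
  -- An accumulation point of the fiber would be a regular point near which the projection is
  -- injective.
  by_contra hinf
  have hcompact : IsCompact (unitCube k ∩ (removeCoord i ∘ B.piece j) ⁻¹' {y}) :=
    isCompact_unitCube.of_isClosed_subset
      (((removeCoord i).continuous.comp_continuousOn
        (B.continuousOn_piece j)).preimage_isClosed_of_isClosed isCompact_unitCube.isClosed
          isClosed_singleton) inter_subset_left
  obtain ⟨u, ⟨hu, huy⟩, hacc⟩ := Set.Infinite.exists_accPt_of_subset_isCompact hinf hcompact
    (inter_subset_inter_left _ (B.regularPoints_subset_unitCube i j))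
  have hreg : u ∈ B.regularPoints i j :=
    mem_regularPoints_of_notMem_criticalValues hu fun h => hy (mem_singleton_iff.1 huy ▸ h)
  have hd : HasFDerivAt (removeCoord i ∘ B.piece j) (B.projDeriv i j u) u :=
    (B.hasFDerivWithinAt_removeCoord_piece i j hu).hasFDerivAt
      (mem_interior_iff_mem_nhds.1 hreg.1)
  have hne : ∀ᶠ z in 𝓝[≠] u, (removeCoord i ∘ B.piece j) z ≠ y :=
    hd.eventually_ne
      ⟨_, ((B.projDeriv i j u).toContinuousLinearEquivOfDetNeZero hreg.2).antilipschitz⟩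
  rw [eventually_nhdsWithin_iff] at hne
  obtain ⟨z, ⟨hzu, hz⟩, hzne⟩ := ((accPt_iff_frequently.1 hacc).and_eventually hne).exists
  exact hzne hzu hz.2

end RegularPoints

section Gauss

variable (i : Fin (k + 1))

/-- The sign of the `i`-th component of the outward normal of a boundary piece. -/
noncomputable def normalSign (j : Fin B.numPieces) (u : Fin k → ℝ) : ℝ :=
  SignType.sign (detCons (B.pieceVec j u) (Pi.single i 1))

theorem detCons_pieceVec_single_ne_zero {j : Fin B.numPieces} {u : Fin k → ℝ}
    (hu : u ∈ B.regularPoints i j) : detCons (B.pieceVec j u) (Pi.single i 1) ≠ 0 := by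
  rw [← abs_pos, ← abs_det_projDeriv, abs_pos]
  exact hu.2

theorem isEndpoint_preimage_coordLine {j : Fin B.numPieces} {u : Fin k → ℝ}
    (hu : u ∈ B.regularPoints i j) (hp : B.piece j u ∉ B.edges) :
    IsEndpoint (coordLine i (removeCoord i (B.piece j u)) ⁻¹' B.carrier) (B.normalSign i j u)
      (B.piece j u i) := by
  have hne := B.detCons_pieceVec_single_ne_zero i hu
  have hout : PointsOutward B.carrier (B.piece j u) (B.normalSign i j u • Pi.single i 1) := by
    refine B.pointsOutward_of_detCons_pos (interior_subset hu.1) hp ?_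
    rw [map_smul, smul_eq_mul, normalSign, sign_mul_self]
    exact abs_pos.2 hne
  refine ⟨?_, hout.mono fun τ hτ => ?_⟩
  · rcases lt_or_gt_of_ne hne with h | h
    · exact Or.inr (by rw [normalSign, sign_neg h, SignType.coe_neg_one])
    · exact Or.inl (by rw [normalSign, sign_pos h, SignType.coe_one])
  · simp only [mem_preimage, sub_eq_add_neg, coordLine_add, coordLine_removeCoord, mul_comm _ τ,
      mul_smul, neg_smul]
    exact ⟨hτ.1, interior_subset (sub_eq_add_neg (B.piece j u) _ ▸ hτ.2)⟩

variable {i} {y : Fin k → ℝ}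

theorem coordLine_piece {j : Fin B.numPieces} {u : Fin k → ℝ} (hu : u ∈ B.regularFiber i y j) :
    coordLine i y (B.piece j u i) = B.piece j u := by
  have hproj : removeCoord i (B.piece j u) = y := hu.2
  rw [← hproj, coordLine_removeCoord]

theorem piece_notMem_edges (hy : y ∉ B.criticalValues i) {j : Fin B.numPieces} {u : Fin k → ℝ}
    (hu : u ∈ B.regularFiber i y j) : B.piece j u ∉ B.edges := by
  have hproj : removeCoord i (B.piece j u) = y := hu.2
  exact notMem_edges_of_notMem_criticalValues (hproj ▸ hy)

theorem injective_piece_regularFiber (hy : y ∉ B.criticalValues i) :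
    Function.Injective fun a : Σ j, ↥(B.regularFiber i y j) => B.piece a.1 a.2 i := by
  rintro ⟨j, u, hu⟩ ⟨j', u', hu'⟩ h
  have heq : B.piece j u = B.piece j' u' := by
    rw [← B.coordLine_piece hu, ← B.coordLine_piece hu']
    exact congrArg _ h
  obtain ⟨rfl, rfl⟩ := (piece_eq_piece_iff_of_notMem_edges (interior_subset hu'.1.1)
    (interior_subset hu.1.1) (B.piece_notMem_edges hy hu')).1 heq
  rfl

theorem frontier_preimage_coordLine_subset (hy : y ∉ B.criticalValues i) :
    frontier (coordLine i y ⁻¹' B.carrier) ⊆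
      range fun a : Σ j, ↥(B.regularFiber i y j) => B.piece a.1 a.2 i := by
  intro t ht
  have hfr := (continuous_coordLine i y).frontier_preimage_subset B.carrier ht
  rw [mem_preimage, B.frontier_eq] at hfr
  obtain ⟨j, u, hu, hut⟩ := mem_iUnion.1 hfr
  have huy : removeCoord i (B.piece j u) = y := by rw [hut, removeCoord_coordLine]
  have hreg := mem_regularPoints_of_notMem_criticalValues hu (huy.symm ▸ hy)
  exact ⟨⟨j, u, hreg, huy⟩, by simp only [hut, coordLine_apply_self]⟩

variable (i) in
theorem setIntegral_coordLine_eq_sum_fiberSum (hy : y ∉ B.criticalValues i)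
    {φ : (Fin (k + 1) → ℝ) → ℝ} (hφ : ContDiff ℝ 1 φ) :
    ∫ t in coordLine i y ⁻¹' B.carrier, fderiv ℝ φ (coordLine i y t) (Pi.single i 1) =
      ∑ j, fiberSum (removeCoord i ∘ B.piece j)
        (fun u => B.normalSign i j u * φ (B.piece j u)) (B.regularPoints i j) y := by
  have (j : Fin B.numPieces) : Fintype ↥(B.regularFiber i y j) :=
    (finite_regularFiber hy j).fintype
  have hend : ∀ a : Σ j, ↥(B.regularFiber i y j), IsEndpoint (coordLine i y ⁻¹' B.carrier)
      (B.normalSign i a.1 a.2) (B.piece a.1 a.2 i) := fun a => by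
    have hproj : removeCoord i (B.piece a.1 a.2) = y := a.2.2.2
    simpa only [hproj] using
      B.isEndpoint_preimage_coordLine i a.2.2.1 (B.piece_notMem_edges hy a.2.2)
  have hderiv : ∀ t, HasDerivAt (fun t => φ (coordLine i y t))
      (fderiv ℝ φ (coordLine i y t) (Pi.single i 1)) t := fun t =>
    (hφ.differentiable one_ne_zero _).hasFDerivAt.comp_hasDerivAt t (hasDerivAt_coordLine i y t)
  rw [setIntegral_eq_sum_endpoints (isCompact_preimage_coordLine i y B.isCompact_carrier)
    (B.injective_piece_regularFiber hy) (B.frontier_preimage_coordLine_subset hy) hend hderiv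
    (((hφ.continuous_fderiv one_ne_zero).comp (continuous_coordLine i y)).clm_apply
      continuous_const), Fintype.sum_sigma]
  refine Finset.sum_congr rfl fun j _ => ?_
  rw [fiberSum]
  change _ = ∑' u : ↥(B.regularFiber i y j), B.normalSign i j u * φ (B.piece j u)
  rw [tsum_fintype]
  exact Finset.sum_congr rfl fun u _ => by rw [B.coordLine_piece u.2]

variable (i)

theorem continuousOn_detCons_pieceVec (j : Fin B.numPieces) (x : Fin (k + 1) → ℝ) :
    ContinuousOn (fun u => detCons (B.pieceVec j u) x) (unitCube k) := by
  simp only [detCons_apply]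
  have hdet : Continuous fun A : Matrix (Fin (k + 1)) (Fin (k + 1)) ℝ => A.det :=
    continuous_id.matrix_det
  refine hdet.comp_continuousOn (continuousOn_pi.2 fun a => ?_)
  refine Fin.cases ?_ (fun a => ?_) a
  · exact continuousOn_const
  · exact B.continuousOn_pieceVec j a

theorem setIntegral_regularPoints_eq (j : Fin B.numPieces) (φ : (Fin (k + 1) → ℝ) → ℝ) :
    ∫ u in B.regularPoints i j,
        |(B.projDeriv i j u).det| • (B.normalSign i j u * φ (B.piece j u)) =
      ∫ u in unitCube k, φ (B.piece j u) * detCons (B.pieceVec j u) (Pi.single i 1) := by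
  rw [← setIntegral_congr_set interior_unitCube_ae_eq,
    setIntegral_eq_of_subset_of_forall_sdiff_eq_zero (s := B.regularPoints i j)
      isOpen_interior.measurableSet (fun u hu => hu.1)]
  · refine setIntegral_congr_fun (B.isOpen_regularPoints i j).measurableSet fun u _ => ?_
    simp only [abs_det_projDeriv, normalSign, smul_eq_mul]
    rw [← mul_assoc, abs_mul_sign, mul_comm]
  · rintro u ⟨hu, hreg⟩
    have hdet : (B.projDeriv i j u).det = 0 := by_contra fun h => hreg ⟨hu, h⟩
    rw [abs_eq_zero.1 ((B.abs_det_projDeriv i j u).symm.trans (abs_eq_zero.2 hdet)), mul_zero]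

theorem integrable_fiberSum_and_integral_fiberSum (j : Fin B.numPieces)
    {φ : (Fin (k + 1) → ℝ) → ℝ} (hφ : Continuous φ) :
    Integrable (fiberSum (removeCoord i ∘ B.piece j)
        (fun u => B.normalSign i j u * φ (B.piece j u)) (B.regularPoints i j)) ∧
      ∫ y, fiberSum (removeCoord i ∘ B.piece j)
          (fun u => B.normalSign i j u * φ (B.piece j u)) (B.regularPoints i j) y =
        ∫ u in unitCube k, φ (B.piece j u) * detCons (B.pieceVec j u) (Pi.single i 1) := by
  rw [← setIntegral_regularPoints_eq]
  have hsub := B.regularPoints_subset_unitCube i j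
  have hmeas := (B.isOpen_regularPoints i j).measurableSet
  refine integrable_fiberSum_and_integral_eq volume hmeas
    (fun u hu => (B.hasFDerivWithinAt_removeCoord_piece i j (hsub hu)).mono hsub)
    (fun u hu => hu.2) ?_
  have hint : IntegrableOn
      (fun u => φ (B.piece j u) * detCons (B.pieceVec j u) (Pi.single i 1)) (unitCube k) :=
    ((hφ.comp_continuousOn (B.continuousOn_piece j)).mul
      (B.continuousOn_detCons_pieceVec j _)).integrableOn_compact isCompact_unitCube
  refine (hint.mono_set hsub).congr_fun (fun u _ => ?_) hmeas
  simp only [abs_det_projDeriv, normalSign, smul_eq_mul]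
  rw [← mul_assoc, abs_mul_sign, mul_comm]

theorem integral_fderiv_single {φ : (Fin (k + 1) → ℝ) → ℝ} (hφ : ContDiff ℝ 1 φ) :
    ∫ x in B.carrier, fderiv ℝ φ x (Pi.single i 1) =
      ∑ j, ∫ u in unitCube k, φ (B.piece j u) * detCons (B.pieceVec j u) (Pi.single i 1) := by
  have hmeas := B.isCompact_carrier.measurableSet
  have hint : Integrable (B.carrier.indicator fun x => fderiv ℝ φ x (Pi.single i 1)) := by
    rw [integrable_indicator_iff hmeas]
    exact ((hφ.continuous_fderiv one_ne_zero).clm_apply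
      continuous_const).continuousOn.integrableOn_compact B.isCompact_carrier
  have hslice : ∀ᵐ y : Fin k → ℝ,
      ∫ t, B.carrier.indicator (fun x => fderiv ℝ φ x (Pi.single i 1)) (coordLine i y t) =
        ∑ j, fiberSum (removeCoord i ∘ B.piece j)
          (fun u => B.normalSign i j u * φ (B.piece j u)) (B.regularPoints i j) y := by
    filter_upwards [measure_eq_zero_iff_ae_notMem.1 (B.volume_criticalValues i)] with y hy
    rw [← B.setIntegral_coordLine_eq_sum_fiberSum i hy hφ, ← integral_indicator
      (isCompact_preimage_coordLine i y B.isCompact_carrier).measurableSet]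
    rfl
  have hfiber := fun j => B.integrable_fiberSum_and_integral_fiberSum i j hφ.continuous
  rw [← integral_indicator hmeas, integral_eq_integral_integral_coordLine i hint,
    integral_congr_ae hslice, integral_finsetSum _ fun j _ => (hfiber j).1]
  exact Finset.sum_congr rfl fun j _ => (hfiber j).2

end Gauss

end DiskDomain

section CrossVec

variable {k : ℕ}

theorem continuous_detCons_left (x : Fin (k + 1) → ℝ) :
    Continuous fun w : Fin k → Fin (k + 1) → ℝ => detCons w x := by
  simp only [detCons_apply]
  refine Continuous.matrix_det (continuous_pi fun a => ?_)
  refine Fin.cases ?_ (fun a => ?_) a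
  · exact continuous_const
  · exact continuous_apply a

/-- The cross product of `k` vectors in `ℝ^(k+1)`, that is the vector representing the linear form
`detCons`. -/
noncomputable def crossVec :
    ContinuousMultilinearMap ℝ (fun _ : Fin k => Fin (k + 1) → ℝ) (Fin (k + 1) → ℝ) :=
  ContinuousMultilinearMap.pi fun i =>
    { toMultilinearMap := ((Matrix.detRowAlternating (R := ℝ) (n := Fin (k + 1))).curryLeft
        (Pi.single i 1)).toMultilinearMap
      cont := continuous_detCons_left (Pi.single i 1) }

theorem crossVec_apply (w : Fin k → Fin (k + 1) → ℝ) (i : Fin (k + 1)) :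
    crossVec w i = detCons w (Pi.single i 1) := rfl

theorem crossVec_dotProduct (w : Fin k → Fin (k + 1) → ℝ) (x : Fin (k + 1) → ℝ) :
    crossVec w ⬝ᵥ x = detCons w x := by
  conv_rhs => rw [pi_eq_sum_univ' x]
  simp only [map_sum, map_smul, dotProduct, crossVec_apply, smul_eq_mul, mul_comm]

theorem not_linearIndependent_of_crossVec_eq_zero {w : Fin k → Fin (k + 1) → ℝ}
    (hw : crossVec w = 0) : ¬ LinearIndependent ℝ w := by
  intro hli
  obtain ⟨x, hx⟩ := exists_linearIndependent_cons_of_lt_finrank hli (by simp)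
  have hunit : IsUnit (Matrix.of (Fin.cons x w : Fin (k + 1) → Fin (k + 1) → ℝ)) :=
    Matrix.linearIndependent_rows_iff_isUnit.1 hx
  rw [Matrix.isUnit_iff_isUnit_det, ← detCons_apply, ← crossVec_dotProduct, hw,
    zero_dotProduct] at hunit
  exact not_isUnit_zero hunit

theorem det_of_apply_eq_zero_of_not_linearIndependent {ι V : Type*} [Fintype ι] [DecidableEq ι]
    [AddCommGroup V] [Module ℝ V] {v : ι → V} (hv : ¬ LinearIndependent ℝ v) (ℓ : ι → V →ₗ[ℝ] ℝ) :
    Matrix.det (Matrix.of fun i l => ℓ l (v i)) = 0 := by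
  rw [Fintype.linearIndependent_iff] at hv
  push Not at hv
  obtain ⟨h, hh, i, hi⟩ := hv
  refine Matrix.exists_vecMul_eq_zero_iff.1 ⟨h, fun h0 => hi (congrFun h0 i), ?_⟩
  ext l
  calc Matrix.vecMul h (Matrix.of fun i l => ℓ l (v i)) l = ∑ a, h a * ℓ l (v a) := rfl
    _ = ℓ l (∑ a, h a • v a) := by simp only [map_sum, map_smul, smul_eq_mul]
    _ = 0 := by rw [hh, map_zero]

theorem detCons_mul_detCons_of_orthogonal (g : Fin k → Fin (k + 1) → ℝ)
    {w : Fin k → Fin (k + 1) → ℝ} {c : Fin (k + 1) → ℝ} (hc : ∀ a, c ⬝ᵥ w a = 0) :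
    detCons w c * detCons g c = c ⬝ᵥ c * Matrix.det (Matrix.of fun a l => g l ⬝ᵥ w a) := by
  let P : Matrix (Fin (k + 1)) (Fin (k + 1)) ℝ :=
    Matrix.of (Fin.cons c w) * (Matrix.of (Fin.cons c g)).transpose
  have hcol : ∀ a : Fin k, P a.succ 0 = 0 := fun a => (dotProduct_comm _ _).trans (hc a)
  have hminor : P.submatrix (Fin.succAbove 0) Fin.succ = Matrix.of fun a l => g l ⬝ᵥ w a := by
    ext a l
    rw [Matrix.of_apply, dotProduct_comm]
    rfl
  have hP : P.det = P 0 0 * Matrix.det (Matrix.of fun a l => g l ⬝ᵥ w a) := by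
    rw [Matrix.det_succ_column_zero, Fin.sum_univ_succ, hminor]
    simp [hcol]
  rw [detCons_apply, detCons_apply, ← Matrix.det_transpose (Matrix.of (Fin.cons c g)),
    ← Matrix.det_mul]
  exact hP

theorem crossVec_dotProduct_crossVec (g w : Fin k → Fin (k + 1) → ℝ) :
    crossVec g ⬝ᵥ crossVec w = Matrix.det (Matrix.of fun a l => g l ⬝ᵥ w a) := by
  by_cases hw : crossVec w = 0
  · rw [hw, dotProduct_zero]
    exact (det_of_apply_eq_zero_of_not_linearIndependent
      (not_linearIndependent_of_crossVec_eq_zero hw) fun l => dotProductBilin ℝ ℝ (g l)).symm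
  · have horth : ∀ a, crossVec w ⬝ᵥ w a = 0 := fun a => by rw [crossVec_dotProduct, detCons_self]
    have h := detCons_mul_detCons_of_orthogonal g horth
    rw [← crossVec_dotProduct w, ← crossVec_dotProduct g] at h
    exact mul_left_cancel₀ (fun h0 => hw (dotProduct_self_eq_zero.1 h0)) h

theorem sum_isAlt_mul_isSymm_eq_zero {ι : Type*} [Fintype ι] [DecidableEq ι]
    {A : LinearMap.BilinForm ℝ (ι → ℝ)} (hA : A.IsAlt) {H : Matrix ι ι ℝ} (hH : H.IsSymm) :
    ∑ i, A (Pi.single i 1) (H i) = 0 := by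
  have hrow : ∀ i, A (Pi.single i 1) (H i) =
      ∑ b, H i b * A (Pi.single i 1) (Pi.single b 1) := fun i => by
    conv_lhs => rw [pi_eq_sum_univ' (H i)]
    simp only [map_sum, map_smul, smul_eq_mul]
  have hneg : ∑ i, A (Pi.single i 1) (H i) = -∑ i, A (Pi.single i 1) (H i) := by
    conv_lhs => rw [Finset.sum_congr rfl fun i _ => hrow i, Finset.sum_comm]
    simp only [hrow, ← Finset.sum_neg_distrib]
    refine Finset.sum_congr rfl fun i _ => Finset.sum_congr rfl fun b _ => ?_
    have hHib : H i b = H b i := hH.apply b i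
    rw [← mul_neg, hA.neg_eq, hHib]
  linarith

theorem sum_crossVec_update_eq_zero (w : Fin k → Fin (k + 1) → ℝ) (l : Fin k)
    {H : Matrix (Fin (k + 1)) (Fin (k + 1)) ℝ} (hH : H.IsSymm) :
    ∑ i, crossVec (Function.update w l (H i)) i = 0 := by
  let δ (x : Fin (k + 1) → ℝ) := (Matrix.detRowAlternating (R := ℝ) (n := Fin (k + 1))).curryLeft x
  let A : LinearMap.BilinForm ℝ (Fin (k + 1) → ℝ) :=
    LinearMap.mk₂ ℝ (fun x y => detCons (Function.update w l y) x) (fun _ _ _ => map_add _ _ _)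
      (fun _ _ _ => map_smul _ _ _) (fun x => (δ x).map_update_add w l)
      (fun c x => (δ x).map_update_smul w l c)
  have hA : A.IsAlt := fun x => by
    have h := detCons_self (Function.update w l x) l
    rwa [Function.update_self] at h
  exact sum_isAlt_mul_isSymm_eq_zero hA hH

end CrossVec

section Divergence

variable {m k : ℕ}

/-- The divergence of a vector field on `ℝ^m`. -/
noncomputable def divergence (X : (Fin m → ℝ) → Fin m → ℝ) (x : Fin m → ℝ) : ℝ :=
  ∑ i, fderiv ℝ X x (Pi.single i 1) i

/-- The vector of partial derivatives. -/
noncomputable def gradVec (f : (Fin m → ℝ) → ℝ) (x : Fin m → ℝ) : Fin m → ℝ :=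
  fun i => fderiv ℝ f x (Pi.single i 1)

theorem gradVec_eq_of_eventuallyEq {f g : (Fin m → ℝ) → ℝ} {x : Fin m → ℝ} (h : f =ᶠ[𝓝 x] g) :
    gradVec f x = gradVec g x :=
  funext fun i => by rw [gradVec, gradVec, h.fderiv_eq]

theorem gradVec_dotProduct (f : (Fin m → ℝ) → ℝ) (x v : Fin m → ℝ) :
    gradVec f x ⬝ᵥ v = fderiv ℝ f x v := by
  conv_rhs => rw [pi_eq_sum_univ' v]
  simp only [map_sum, map_smul, dotProduct, gradVec, smul_eq_mul, mul_comm]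

theorem divergence_smul {b : (Fin m → ℝ) → ℝ} {X : (Fin m → ℝ) → Fin m → ℝ} {x : Fin m → ℝ}
    (hb : DifferentiableAt ℝ b x) (hX : DifferentiableAt ℝ X x) :
    divergence (fun x => b x • X x) x = b x * divergence X x + gradVec b x ⬝ᵥ X x := by
  simp only [divergence, fderiv_fun_smul hb hX, add_apply, Pi.add_apply,
    FunLike.coe_smul, Pi.smul_apply, ContinuousLinearMap.smulRight_apply, smul_eq_mul,
    Finset.sum_add_distrib, ← Finset.mul_sum, dotProduct, gradVec]

theorem contDiff_gradVec {f : (Fin m → ℝ) → ℝ} (hf : ContDiff ℝ 2 f) :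
    ContDiff ℝ 1 (gradVec f) :=
  contDiff_pi.2 fun _ => (hf.fderiv_right (m := 1) (by norm_num)).clm_apply contDiff_const

theorem fderiv_gradVec {f : (Fin m → ℝ) → ℝ} (hf : ContDiff ℝ 2 f) (x v : Fin m → ℝ)
    (i : Fin m) :
    fderiv ℝ (gradVec f) x v i = fderiv ℝ (fderiv ℝ f) x v (Pi.single i 1) := by
  have hd : DifferentiableAt ℝ (fderiv ℝ f) x :=
    (hf.fderiv_right (m := 1) (by norm_num)).differentiable one_ne_zero x
  have hgrad : HasFDerivAt (gradVec f)
      (ContinuousLinearMap.pi fun i => (fderiv ℝ (fderiv ℝ f) x).flip (Pi.single i 1)) x :=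
    hasFDerivAt_pi.2 fun i => by
      have h := hd.hasFDerivAt.clm_apply (hasFDerivAt_const (Pi.single i (1 : ℝ) : Fin m → ℝ) x)
      rwa [ContinuousLinearMap.comp_zero, zero_add] at h
  rw [hgrad.fderiv]
  rfl

theorem divergence_crossVec_gradVec {g : Fin k → (Fin (k + 1) → ℝ) → ℝ}
    (hg : ∀ l, ContDiff ℝ 2 (g l)) (x : Fin (k + 1) → ℝ) :
    divergence (fun z => crossVec fun l => gradVec (g l) z) x = 0 := by
  have hgrad : HasFDerivAt (fun z l => gradVec (g l) z)
      (ContinuousLinearMap.pi fun l => fderiv ℝ (gradVec (g l)) x) x :=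
    hasFDerivAt_pi.2 fun l => ((contDiff_gradVec (hg l)).differentiable one_ne_zero x).hasFDerivAt
  have hcross : HasFDerivAt (fun z => crossVec fun l => gradVec (g l) z) _ x :=
    (crossVec.hasFDerivAt fun l => gradVec (g l) x).comp x hgrad
  have hsymm : ∀ l, (Matrix.of fun i => fderiv ℝ (gradVec (g l)) x (Pi.single i 1)).IsSymm :=
    fun l => Matrix.IsSymm.ext fun a b => by
      simp only [Matrix.of_apply, fderiv_gradVec (hg l)]
      exact ((hg l).contDiffAt.isSymmSndFDerivAt (by simp)).eq _ _
  have hpartial : ∀ i, fderiv ℝ (fun z => crossVec fun l => gradVec (g l) z) x (Pi.single i 1) i =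
      ∑ l, crossVec (Function.update (fun l => gradVec (g l) x) l
        (fderiv ℝ (gradVec (g l)) x (Pi.single i 1))) i := fun i => by
    rw [hcross.fderiv, ContinuousLinearMap.comp_apply, ContinuousMultilinearMap.linearDeriv_apply,
      Finset.sum_apply]
    rfl
  simp only [divergence, hpartial]
  rw [Finset.sum_comm]
  exact Finset.sum_eq_zero fun l _ => sum_crossVec_update_eq_zero _ l (hsymm l)

end Divergence

namespace DiskDomain

variable {k : ℕ} (B : DiskDomain k)

theorem integral_divergence {X : (Fin (k + 1) → ℝ) → Fin (k + 1) → ℝ} (hX : ContDiff ℝ 1 X) :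
    ∫ x in B.carrier, divergence X x =
      ∑ j, ∫ u in unitCube k, X (B.piece j u) ⬝ᵥ crossVec (B.pieceVec j u) := by
  have hXi : ∀ i, ContDiff ℝ 1 fun x => X x i := contDiff_pi.1 hX
  have hcoord : ∀ x i, fderiv ℝ X x (Pi.single i 1) i =
      fderiv ℝ (fun x => X x i) x (Pi.single i 1) := fun x i => by
    rw [fderiv_apply (hX.differentiable one_ne_zero x)]
    rfl
  have hin : ∀ i, IntegrableOn (fun x => fderiv ℝ (fun x => X x i) x (Pi.single i 1)) B.carrier :=
    fun i => (((hXi i).continuous_fderiv one_ne_zero).clm_apply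
      continuous_const).continuousOn.integrableOn_compact B.isCompact_carrier
  have hbd : ∀ j i, IntegrableOn
      (fun u => X (B.piece j u) i * detCons (B.pieceVec j u) (Pi.single i 1)) (unitCube k) :=
    fun j i => (((hXi i).continuous.comp_continuousOn (B.continuousOn_piece j)).mul
      (B.continuousOn_detCons_pieceVec j _)).integrableOn_compact isCompact_unitCube
  simp only [divergence, hcoord, dotProduct, crossVec_apply]
  rw [integral_finsetSum _ fun i _ => hin i,
    Finset.sum_congr rfl fun i _ => B.integral_fderiv_single i (hXi i), Finset.sum_comm]
  exact Finset.sum_congr rfl fun j _ => (integral_finsetSum _ fun i _ => hbd j i).symm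

/-- Stokes' formula for `b dg₁ ∧ … ∧ dg_k`: apply the Gauss formula to `b` times the cross product
of the gradients, which is divergence free. -/
theorem stokes_of_contDiff_two {b : (Fin (k + 1) → ℝ) → ℝ} {g : Fin k → (Fin (k + 1) → ℝ) → ℝ}
    (hb : ContDiff ℝ 1 b) (hg : ∀ l, ContDiff ℝ 2 (g l)) :
    ∫ x in B.carrier, detCons (fun l => gradVec (g l) x) (gradVec b x) =
      ∑ j, ∫ u in unitCube k, b (B.piece j u) *
        Matrix.det (Matrix.of fun i l => fderiv ℝ (g l) (B.piece j u) (B.pieceVec j u i)) := by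
  have hX : ContDiff ℝ 1 fun x => crossVec fun l => gradVec (g l) x :=
    crossVec.contDiff.comp (contDiff_pi.2 fun l => contDiff_gradVec (hg l))
  have hdiv : ∀ x, divergence (fun x => b x • crossVec fun l => gradVec (g l) x) x =
      detCons (fun l => gradVec (g l) x) (gradVec b x) := fun x => by
    rw [divergence_smul (hb.differentiable one_ne_zero x) (hX.differentiable one_ne_zero x),
      divergence_crossVec_gradVec hg, mul_zero, zero_add, dotProduct_comm, crossVec_dotProduct]
  rw [← integral_congr_ae (ae_of_all _ hdiv)]
  refine (B.integral_divergence (hb.smul hX)).trans ?_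
  simp only [Pi.smul_apply', smul_dotProduct, smul_eq_mul, crossVec_dotProduct_crossVec,
    gradVec_dotProduct]

end DiskDomain

section Approximation

variable {E : Type*} [NormedAddCommGroup E] [NormedSpace ℝ E] [FiniteDimensional ℝ E]

theorem exists_contDiff_one_eventuallyEq {f : E → ℝ} {K : Set E} (hK : IsCompact K)
    (hf : ∀ x ∈ K, ContDiffAt ℝ 1 f x) :
    ∃ g : E → ℝ, ContDiff ℝ 1 g ∧ HasCompactSupport g ∧ ∀ x ∈ K, g =ᶠ[𝓝 x] f := by
  have hopen : IsOpen {x | ContDiffAt ℝ 1 f x} :=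
    isOpen_iff_eventually.2 fun x (hx : ContDiffAt ℝ 1 f x) => hx.eventually (by simp)
  obtain ⟨t, ht, hKt, htf⟩ := exists_compact_between hK hopen hf
  obtain ⟨χ, hχ1, hχ0, -⟩ := exists_contMDiffMap_one_nhds_of_subset_interior (n := ⊤) 𝓘(ℝ, E)
    hK.isClosed hKt
  have hχ : ContDiff ℝ 1 χ := χ.contMDiff.contDiff.of_le (by simp)
  refine ⟨fun x => χ x * f x, contDiff_iff_contDiffAt.2 fun x => ?_,
    HasCompactSupport.intro ht fun x hx => by rw [hχ0 x hx, zero_mul], fun x hx => ?_⟩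
  · by_cases hx : x ∈ t
    · exact hχ.contDiffAt.mul (htf hx)
    · refine (contDiffAt_const (c := (0 : ℝ))).congr_of_eventuallyEq ?_
      filter_upwards [ht.isClosed.isOpen_compl.mem_nhds hx] with y hy
      rw [hχ0 y hy, zero_mul]
  · filter_upwards [hχ1.filter_mono (nhds_le_nhdsSet hx)] with y hy
    rw [hy, one_mul]

theorem exists_contDiff_norm_fderiv_sub_le {f : E → ℝ} (hf : ContDiff ℝ 1 f)
    (hc : HasCompactSupport f) {ε : ℝ} (hε : 0 < ε) :
    ∃ g : E → ℝ, ContDiff ℝ ∞ g ∧ ∀ x, ‖fderiv ℝ g x - fderiv ℝ f x‖ ≤ ε := by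
  borelize E
  have huc : UniformContinuous (fderiv ℝ f) :=
    (hc.fderiv ℝ).uniformContinuous_of_continuous (hf.continuous_fderiv one_ne_zero)
  obtain ⟨δ, hδ, hδf⟩ := Metric.uniformContinuous_iff.1 huc ε hε
  let φ : ContDiffBump (0 : E) := ⟨δ / 2, δ, half_pos hδ, half_lt_self hδ⟩
  let μ : Measure E := Measure.addHaar
  let L := ContinuousLinearMap.lsmul ℝ ℝ (E := ℝ)
  have hfderiv : ∀ x, fderiv ℝ (convolution (φ.normed μ) f L μ) x =
      convolution (φ.normed μ) (fderiv ℝ f) (ContinuousLinearMap.lsmul ℝ ℝ) μ x := fun x => by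
    rw [(hc.hasFDerivAt_convolution_right L
      (φ.contDiff_normed (n := 0)).continuous.locallyIntegrable hf x).fderiv]
    rfl
  refine ⟨convolution (φ.normed μ) f L μ, ?_, fun x => ?_⟩
  · exact φ.hasCompactSupport_normed.contDiff_convolution_left _ φ.contDiff_normed
      hf.continuous.locallyIntegrable
  · rw [hfderiv, ← dist_eq_norm]
    exact φ.dist_normed_convolution_le (hf.continuous_fderiv one_ne_zero).aestronglyMeasurable
      fun y hy => (hδf hy).le

theorem exists_seq_contDiff_tendsto_fderiv {f : E → ℝ} (hf : ContDiff ℝ 1 f)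
    (hc : HasCompactSupport f) :
    ∃ (g : ℕ → E → ℝ) (C : ℝ), (∀ n, ContDiff ℝ ∞ (g n)) ∧ (∀ n x, ‖fderiv ℝ (g n) x‖ ≤ C) ∧
      ∀ x, Filter.Tendsto (fun n => fderiv ℝ (g n) x) Filter.atTop (𝓝 (fderiv ℝ f x)) := by
  choose g hg hgf using fun n : ℕ =>
    exists_contDiff_norm_fderiv_sub_le hf hc (ε := 1 / ((n : ℝ) + 1)) (by positivity)
  obtain ⟨C, hC⟩ := (hc.fderiv ℝ).exists_bound_of_continuous (hf.continuous_fderiv one_ne_zero)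
  refine ⟨g, 1 + C, hg, fun n x => ?_, fun x => tendsto_iff_norm_sub_tendsto_zero.2 <|
    squeeze_zero (fun _ => norm_nonneg _) (fun n => hgf n x)
      tendsto_one_div_add_atTop_nhds_zero_nat⟩
  have hn : 1 / ((n : ℝ) + 1) ≤ 1 := (div_le_one (by positivity)).2 (by simp)
  calc ‖fderiv ℝ (g n) x‖ = ‖fderiv ℝ (g n) x - fderiv ℝ f x + fderiv ℝ f x‖ := by
        rw [sub_add_cancel]
    _ ≤ 1 + C := norm_add_le_of_le ((hgf n x).trans hn) (hC x)

end Approximation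

theorem tendsto_setIntegral_comp_prodMk {X V : Type*} [TopologicalSpace X] [MeasurableSpace X]
    [OpensMeasurableSpace X] [T2Space X] [TopologicalSpace V] [T2Space V] {μ : Measure X}
    [IsFiniteMeasureOnCompacts μ] {K : Set X} {Q : Set V} (hK : IsCompact K) (hQ : IsCompact Q)
    {F : X × V → ℝ} (hF : ContinuousOn F (K ×ˢ Q)) {v : ℕ → X → V} {w : X → V}
    (hv : ∀ n, ContinuousOn (v n) K) (hvQ : ∀ n, MapsTo (v n) K Q)
    (hlim : ∀ x ∈ K, Filter.Tendsto (fun n => v n x) Filter.atTop (𝓝 (w x))) :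
    Filter.Tendsto (fun n => ∫ x in K, F (x, v n x) ∂μ) Filter.atTop
      (𝓝 (∫ x in K, F (x, w x) ∂μ)) := by
  have : IsFiniteMeasure (μ.restrict K) := ⟨by simpa using hK.measure_lt_top⟩
  obtain ⟨C, hC⟩ := (hK.prod hQ).exists_bound_of_continuousOn hF
  refine tendsto_integral_filter_of_norm_le_const (Filter.Eventually.of_forall fun n => ?_)
    ⟨C, Filter.Eventually.of_forall fun n => ?_⟩ ?_
  · exact (hF.comp (continuousOn_id.prodMk (hv n)) fun x hx =>
      ⟨hx, hvQ n hx⟩).aestronglyMeasurable hK.measurableSet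
  · filter_upwards [ae_restrict_mem hK.measurableSet] with x hx using hC _ ⟨hx, hvQ n hx⟩
  · filter_upwards [ae_restrict_mem hK.measurableSet] with x hx
    have hwx : w x ∈ Q :=
      hQ.isClosed.mem_of_tendsto (hlim x hx) (Filter.Eventually.of_forall fun n => hvQ n hx)
    exact (hF (x, w x) ⟨hx, hwx⟩).tendsto.comp (tendsto_nhdsWithin_iff.2
      ⟨tendsto_const_nhds.prodMk_nhds (hlim x hx),
        Filter.Eventually.of_forall fun n => ⟨hx, hvQ n hx⟩⟩)

namespace DiskDomain

variable {k : ℕ} (B : DiskDomain k)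

theorem continuous_detCons_prod {b : (Fin (k + 1) → ℝ) → ℝ} (hb : ContDiff ℝ 1 b) :
    Continuous fun p : (Fin (k + 1) → ℝ) × (Fin k → (Fin (k + 1) → ℝ) →L[ℝ] ℝ) =>
      detCons (fun l i => p.2 l (Pi.single i 1)) (gradVec b p.1) := by
  have hgrad : Continuous (gradVec b) :=
    continuous_pi fun i => (hb.continuous_fderiv one_ne_zero).clm_apply continuous_const
  simp only [detCons_apply]
  refine Continuous.matrix_det (continuous_pi (Fin.cases (hgrad.comp continuous_fst) fun l => ?_))
  exact continuous_pi fun i =>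
    ((continuous_apply l).comp continuous_snd).clm_apply continuous_const

theorem continuousOn_mul_det_prod {b : (Fin (k + 1) → ℝ) → ℝ} (hb : Continuous b)
    (j : Fin B.numPieces) (Q : Set (Fin k → (Fin (k + 1) → ℝ) →L[ℝ] ℝ)) :
    ContinuousOn (fun p : (Fin k → ℝ) × (Fin k → (Fin (k + 1) → ℝ) →L[ℝ] ℝ) =>
      b (B.piece j p.1) * Matrix.det (Matrix.of fun i l => p.2 l (B.pieceVec j p.1 i)))
      (unitCube k ×ˢ Q) := by
  have hdet : Continuous fun A : Matrix (Fin k) (Fin k) ℝ => A.det := continuous_id.matrix_det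
  have hfst : MapsTo Prod.fst (unitCube k ×ˢ Q) (unitCube k) := fun _ hp => hp.1
  refine (hb.comp_continuousOn ((B.continuousOn_piece j).comp continuousOn_fst hfst)).mul
    (hdet.comp_continuousOn (continuousOn_pi.2 fun i => continuousOn_pi.2 fun l => ?_))
  exact ((continuous_apply l).comp continuous_snd).continuousOn.clm_apply
    ((B.continuousOn_pieceVec j i).comp continuousOn_fst hfst)

theorem stokes_of_hasCompactSupport {b : (Fin (k + 1) → ℝ) → ℝ}
    {g : Fin k → (Fin (k + 1) → ℝ) → ℝ} (hb : ContDiff ℝ 1 b) (hg : ∀ l, ContDiff ℝ 1 (g l))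
    (hgc : ∀ l, HasCompactSupport (g l)) :
    ∫ x in B.carrier, detCons (fun l => gradVec (g l) x) (gradVec b x) =
      ∑ j, ∫ u in unitCube k, b (B.piece j u) *
        Matrix.det (Matrix.of fun i l => fderiv ℝ (g l) (B.piece j u) (B.pieceVec j u i)) := by
  choose G C hG hGC hGlim using fun l => exists_seq_contDiff_tendsto_fderiv (hg l) (hgc l)
  have hQ : IsCompact
      (univ.pi fun l => Metric.closedBall (0 : (Fin (k + 1) → ℝ) →L[ℝ] ℝ) (C l)) :=
    isCompact_univ_pi fun l => isCompact_closedBall _ _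
  have hGQ : ∀ n x, (fun l => fderiv ℝ (G l n) x) ∈ univ.pi fun l => Metric.closedBall 0 (C l) :=
    fun n x l _ => mem_closedBall_zero_iff.2 (hGC l n x)
  have hGc : ∀ n, Continuous fun x l => fderiv ℝ (G l n) x := fun n =>
    continuous_pi fun l => (hG l n).continuous_fderiv (by simp)
  have hinner := tendsto_setIntegral_comp_prodMk (μ := volume) B.isCompact_carrier hQ
    (continuous_detCons_prod hb).continuousOn (fun n => (hGc n).continuousOn)
    (fun n x _ => hGQ n x) (fun x _ => tendsto_pi_nhds.2 fun l => hGlim l x)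
  have hbdry := tendsto_finsetSum Finset.univ fun j _ =>
    tendsto_setIntegral_comp_prodMk (μ := volume) isCompact_unitCube hQ
      (B.continuousOn_mul_det_prod hb.continuous j _)
      (fun n => (hGc n).comp_continuousOn (B.continuousOn_piece j)) (fun n u _ => hGQ n _)
      (fun u _ => tendsto_pi_nhds.2 fun l => hGlim l (B.piece j u))
  refine tendsto_nhds_unique hinner (hbdry.congr fun n => ?_)
  exact (B.stokes_of_contDiff_two hb fun l => (hG l n).of_le ENat.LEInfty.out).symm

/-- The functions `g l` are approximated in `C¹` by smooth ones. -/
theorem stokes {b : (Fin (k + 1) → ℝ) → ℝ} {g : Fin k → (Fin (k + 1) → ℝ) → ℝ}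
    (hb : ∀ x ∈ B.carrier, ContDiffAt ℝ 1 b x) (hg : ∀ l, ∀ x ∈ B.carrier, ContDiffAt ℝ 1 (g l) x) :
    ∫ x in B.carrier, detCons (fun l => gradVec (g l) x) (gradVec b x) =
      ∑ j, ∫ u in unitCube k, b (B.piece j u) *
        Matrix.det (Matrix.of fun i l => fderiv ℝ (g l) (B.piece j u) (B.pieceVec j u i)) := by
  obtain ⟨b', hb', -, hbb'⟩ := exists_contDiff_one_eventuallyEq B.isCompact_carrier hb
  choose g' hg' hg'c hgg' using fun l =>
    exists_contDiff_one_eventuallyEq B.isCompact_carrier (hg l)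
  have hfderiv : ∀ l, ∀ x ∈ B.carrier, fderiv ℝ (g' l) x = fderiv ℝ (g l) x := fun l x hx =>
    (hgg' l x hx).fderiv_eq
  have hstokes := B.stokes_of_hasCompactSupport hb' hg' hg'c
  rw [setIntegral_congr_fun (g := fun x => detCons (fun l => gradVec (g l) x) (gradVec b x))
    B.isCompact_carrier.measurableSet fun x hx => by
      simp only [gradVec_eq_of_eventuallyEq (hgg' _ x hx), gradVec_eq_of_eventuallyEq (hbb' x hx)]]
    at hstokes
  refine hstokes.trans (Finset.sum_congr rfl fun j _ =>
    setIntegral_congr_fun isCompact_unitCube.measurableSet fun u hu => ?_)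
  simp only [hfderiv _ _ (B.piece_mem_carrier j hu), (hbb' _ (B.piece_mem_carrier j hu)).eq_of_nhds]

end DiskDomain

section LipschitzEnvelope

variable {X : Type*} [PseudoMetricSpace X] {s : Set X} {f : X → ℝ} {L : ℝ≥0} {c : ℝ}

/-- The greatest `L`-Lipschitz function that is at most `f` on `s`, as in McShane's extension
theorem; a junk value unless `s` is nonempty and `f` is bounded below on `s`. -/
noncomputable def lipschitzEnvelope (L : ℝ≥0) (s : Set X) (f : X → ℝ) (x : X) : ℝ :=
  ⨅ y : s, (f y + L * dist x y)

theorem le_lipschitzEnvelope (hs : s.Nonempty) {x : X} (h : ∀ y ∈ s, c ≤ f y + L * dist x y) :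
    c ≤ lipschitzEnvelope L s f x :=
  have := hs.to_subtype
  le_ciInf fun y => h y y.2

theorem lipschitzEnvelope_le_add (hc : ∀ y ∈ s, c ≤ f y) (x : X) {y : X} (hy : y ∈ s) :
    lipschitzEnvelope L s f x ≤ f y + L * dist x y := by
  refine ciInf_le ⟨c, ?_⟩ (⟨y, hy⟩ : s)
  rintro _ ⟨z, rfl⟩
  exact le_add_of_le_of_nonneg (hc z z.2) (by positivity)

theorem lipschitzEnvelope_le (hc : ∀ y ∈ s, c ≤ f y) {x : X} (hx : x ∈ s) :
    lipschitzEnvelope L s f x ≤ f x := by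
  simpa only [dist_self, mul_zero, add_zero] using lipschitzEnvelope_le_add hc x hx

theorem lipschitzWith_lipschitzEnvelope (hs : s.Nonempty) (hc : ∀ y ∈ s, c ≤ f y) :
    LipschitzWith L (lipschitzEnvelope L s f) :=
  LipschitzWith.of_le_add_mul L fun x z => sub_le_iff_le_add.1 <|
    le_lipschitzEnvelope hs fun y hy => by
      have htri := mul_le_mul_of_nonneg_left (dist_triangle x z y) L.coe_nonneg
      linarith [lipschitzEnvelope_le_add (L := L) hc x hy]

end LipschitzEnvelope

theorem rpow_le_rpow_add_rpow_sub_one_mul {d ε θ : ℝ} (hd : 0 ≤ d) (hε : 0 < ε) (hθ₀ : 0 ≤ θ)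
    (hθ₁ : θ ≤ 1) : d ^ θ ≤ ε ^ θ + ε ^ (θ - 1) * d := by
  rcases le_total d ε with hdε | hdε
  · exact le_add_of_le_of_nonneg (Real.rpow_le_rpow hd hdε hθ₀) (by positivity)
  · have hd0 : 0 < d := hε.trans_le hdε
    refine le_add_of_nonneg_of_le (by positivity) ?_
    calc d ^ θ = d ^ (θ - 1) * d := by rw [Real.rpow_sub_one hd0.ne', div_mul_cancel₀ _ hd0.ne']
      _ ≤ ε ^ (θ - 1) * d := mul_le_mul_of_nonneg_right
          (Real.rpow_le_rpow_of_nonpos hε hdε (by linarith)) hd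

section Mollification

variable {E : Type*} [NormedAddCommGroup E] [NormedSpace ℝ E] [FiniteDimensional ℝ E]

theorem abs_integral_normed_mul_le [MeasurableSpace E] [BorelSpace E] {μ : Measure E}
    [IsLocallyFiniteMeasure μ] [μ.IsOpenPosMeasure] {a : E} (φ : ContDiffBump a) {f : E → ℝ} {C : ℝ}
    (hf : ∀ t, |f t| ≤ C) : |∫ t, φ.normed μ t * f t ∂μ| ≤ C := by
  have hφ : Integrable (φ.normed μ) μ :=
    (φ.contDiff_normed (μ := μ) (n := 0)).continuous.integrable_of_hasCompactSupport
      φ.hasCompactSupport_normed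
  calc |∫ t, φ.normed μ t * f t ∂μ| ≤ ∫ t, φ.normed μ t * C ∂μ := by
        rw [← Real.norm_eq_abs]
        refine norm_integral_le_of_norm_le (hφ.mul_const C) (ae_of_all _ fun t => ?_)
        rw [norm_mul, Real.norm_of_nonneg (φ.nonneg_normed t)]
        exact mul_le_mul_of_nonneg_left (hf t) (φ.nonneg_normed t)
    _ = C := by rw [integral_mul_const, φ.integral_normed, one_mul]

theorem exists_contDiff_approx_of_lipschitz {h : E → ℝ} {L : ℝ≥0} (hL : LipschitzWith L h) {H : ℝ}
    (hH : ∀ x, |h x| ≤ H) {ε : ℝ} (hε : 0 < ε) :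
    ∃ g : E → ℝ, ContDiff ℝ ∞ g ∧ (∀ x, |g x| ≤ H) ∧ (∀ x, |g x - h x| ≤ L * ε) ∧
      LipschitzWith L g := by
  borelize E
  let φ : ContDiffBump (0 : E) := ⟨ε / 2, ε, half_pos hε, half_lt_self hε⟩
  let μ : Measure E := Measure.addHaar
  let g : E → ℝ := convolution (φ.normed μ) h (ContinuousLinearMap.lsmul ℝ ℝ) μ
  have hg : ∀ x, g x = ∫ t, φ.normed μ t * h (x - t) ∂μ := fun x => rfl
  have hint : ∀ x, Integrable (fun t => φ.normed μ t * h (x - t)) μ := fun x =>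
    ((φ.contDiff_normed (n := 0)).continuous.mul
      (hL.continuous.comp (continuous_sub_left x))).integrable_of_hasCompactSupport
      φ.hasCompactSupport_normed.mul_right
  refine ⟨g, ?_, fun x => ?_, fun x => ?_, LipschitzWith.of_dist_le_mul fun x y => ?_⟩
  · exact φ.hasCompactSupport_normed.contDiff_convolution_left _ φ.contDiff_normed
      hL.continuous.locallyIntegrable
  · rw [hg]
    exact abs_integral_normed_mul_le φ fun t => hH _
  · rw [← Real.dist_eq]
    refine φ.dist_normed_convolution_le hL.continuous.aestronglyMeasurable fun y hy => ?_
    exact (hL.dist_le_mul y x).trans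
      (mul_le_mul_of_nonneg_left (Metric.mem_ball.1 hy).le L.coe_nonneg)
  · rw [Real.dist_eq, hg, hg, ← integral_sub (hint x) (hint y)]
    simp only [← mul_sub]
    refine abs_integral_normed_mul_le φ fun t => ?_
    simpa only [Real.dist_eq, dist_sub_right] using hL.dist_le_mul (x - t) (y - t)

/-- Mollification at scale `ε` of the Lipschitz envelope with slope `H ε ^ (θ - 1)`. -/
theorem exists_contDiff_approx_of_holder {s : Set E} {f : E → ℝ} {H ε θ : ℝ} (hε : 0 < ε)
    (hH : 0 ≤ H) (hθ₀ : 0 ≤ θ) (hθ₁ : θ ≤ 1) (hb : ∀ x ∈ s, |f x| ≤ H)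
    (hh : ∀ x ∈ s, ∀ y ∈ s, |f x - f y| ≤ H * dist x y ^ θ) :
    ∃ g : E → ℝ, ContDiff ℝ ∞ g ∧ (∀ x, |g x| ≤ H) ∧ (∀ x ∈ s, |g x - f x| ≤ 2 * H * ε ^ θ) ∧
      ∀ x, ‖fderiv ℝ g x‖ ≤ H * ε ^ (θ - 1) := by
  rcases s.eq_empty_or_nonempty with rfl | hs
  · refine ⟨fun _ => 0, contDiff_const, by simpa using hH, by simp, fun x => ?_⟩
    rw [fderiv_fun_const, Pi.zero_apply, norm_zero]
    positivity
  obtain ⟨L, hL⟩ : ∃ L : ℝ≥0, (L : ℝ) = H * ε ^ (θ - 1) := CanLift.prf _ (by positivity)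
  have hLε : L * ε = H * ε ^ θ := by
    rw [hL, Real.rpow_sub_one hε.ne', mul_assoc, div_mul_cancel₀ _ hε.ne']
  have hfH : ∀ x ∈ s, -H ≤ f x := fun x hx => (abs_le.1 (hb x hx)).1
  let h := lipschitzEnvelope L s f
  have hlower : ∀ x ∈ s, f x - H * ε ^ θ ≤ h x := fun x hx =>
    le_lipschitzEnvelope hs fun y hy => by
      have hdist := mul_le_mul_of_nonneg_left
        (rpow_le_rpow_add_rpow_sub_one_mul (dist_nonneg (x := x) (y := y)) hε hθ₀ hθ₁) hH
      rw [mul_add, ← mul_assoc, ← hL] at hdist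
      linarith [(abs_le.1 (hh x hx y hy)).2]
  have hbound : ∀ x, |min (h x) H| ≤ H := fun x => abs_le.2 ⟨le_min (le_lipschitzEnvelope hs
    fun y hy => le_add_of_le_of_nonneg (hfH y hy) (by positivity)) (by linarith), min_le_right _ _⟩
  obtain ⟨g, hg, hgH, hgh, hgL⟩ := exists_contDiff_approx_of_lipschitz
    ((lipschitzWith_lipschitzEnvelope hs hfH).min_const H) hbound hε
  refine ⟨g, hg, hgH, fun x hx => ?_, fun x =>
    (norm_fderiv_le_of_lipschitz ℝ hgL).trans_eq hL⟩
  have hupper : h x ≤ f x := lipschitzEnvelope_le hfH hx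
  have hgx := hgh x
  rw [min_eq_left (hupper.trans (abs_le.1 (hb x hx)).2), hLε] at hgx
  have hH0 : 0 ≤ H * ε ^ θ := by positivity
  have hlow := hlower x hx
  rw [abs_le] at hgx ⊢
  constructor <;> linarith

end Mollification

section Gram

variable {ι : Type*} [Fintype ι] [DecidableEq ι]

theorem abs_det_le_factorial_mul_prod {A : Matrix ι ι ℝ} {c : ι → ℝ} (h : ∀ i j, |A i j| ≤ c j) :
    |A.det| ≤ (Fintype.card ι).factorial * ∏ j, c j := by
  have hterm : ∀ σ : Equiv.Perm ι,
      |Equiv.Perm.sign σ • ∏ i, A (σ i) i| = ∏ i, |A (σ i) i| := fun σ => by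
    rw [← Finset.abs_prod]
    exact AbsoluteValue.abs.map_units_int_smul _ _
  calc |A.det| ≤ ∑ σ : Equiv.Perm ι, ∏ i, |A (σ i) i| := by
        rw [Matrix.det_apply]
        exact (Finset.abs_sum_le_sum_abs _ _).trans_eq (Finset.sum_congr rfl fun σ _ => hterm σ)
    _ ≤ ∑ _σ : Equiv.Perm ι, ∏ j, c j := Finset.sum_le_sum fun σ _ =>
        Finset.prod_le_prod (fun i _ => abs_nonneg _) fun i _ => h _ _
    _ = (Fintype.card ι).factorial * ∏ j, c j := by
        rw [Finset.sum_const, Finset.card_univ, Fintype.card_perm, nsmul_eq_mul]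

variable {V : Type*} [NormedAddCommGroup V] [InnerProductSpace ℝ V]

theorem sqrt_det_gram_eq_abs_det_repr (b : OrthonormalBasis ι ℝ V) (v : ι → V) :
    √(Matrix.gram ℝ v).det = |Matrix.det (Matrix.of fun i j => b.repr (v j) i)| := by
  rw [Matrix.gram_eq_conjTranspose_mul b v, Matrix.det_mul, Matrix.det_conjTranspose, star_trivial,
    Real.sqrt_mul_self_eq_abs]

theorem abs_det_le_sqrt_det_gram_of_orthonormalBasis (b : OrthonormalBasis ι ℝ V)
    (ℓ : ι → V →ₗ[ℝ] ℝ) (v : ι → V) {c : ι → ℝ} (hc : ∀ l v, |ℓ l v| ≤ c l * ‖v‖) :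
    |Matrix.det (Matrix.of fun i l => ℓ l (v i))| ≤
      (Fintype.card ι).factorial * (∏ l, c l) * √(Matrix.gram ℝ v).det := by
  have hfactor : (Matrix.of fun i l => ℓ l (v i)) =
      (Matrix.of fun i j => b.repr (v j) i).transpose * Matrix.of fun a l => ℓ l (b a) := by
    ext i l
    simp only [Matrix.of_apply, Matrix.mul_apply, Matrix.transpose_apply]
    conv_lhs => rw [← b.sum_repr (v i)]
    simp only [map_sum, map_smul, smul_eq_mul]
  have hb : |(Matrix.of fun a l => ℓ l (b a)).det| ≤ (Fintype.card ι).factorial * ∏ l, c l :=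
    abs_det_le_factorial_mul_prod fun a l => by
      simpa only [b.norm_eq_one, mul_one, Matrix.of_apply] using hc l (b a)
  rw [hfactor, Matrix.det_mul, Matrix.det_transpose, abs_mul, sqrt_det_gram_eq_abs_det_repr b,
    mul_comm]
  exact mul_le_mul_of_nonneg_right hb (abs_nonneg _)

theorem abs_det_le_sqrt_det_gram (ℓ : ι → V →ₗ[ℝ] ℝ) (v : ι → V) {c : ι → ℝ}
    (hc : ∀ l v, |ℓ l v| ≤ c l * ‖v‖) :
    |Matrix.det (Matrix.of fun i l => ℓ l (v i))| ≤
      (Fintype.card ι).factorial * (∏ l, c l) * √(Matrix.gram ℝ v).det := by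
  by_cases hv : LinearIndependent ℝ v
  · let S := Submodule.span ℝ (range v)
    have : FiniteDimensional ℝ S := FiniteDimensional.span_of_finite ℝ (finite_range v)
    have hcard : Fintype.card (Fin (Module.finrank ℝ S)) = Fintype.card ι := by
      rw [Fintype.card_fin, finrank_span_eq_card hv]
    exact abs_det_le_sqrt_det_gram_of_orthonormalBasis
      ((stdOrthonormalBasis ℝ S).reindex (Fintype.equivOfCardEq hcard))
      (fun l => (ℓ l).comp S.subtype)
      (fun i => ⟨v i, Submodule.subset_span (mem_range_self i)⟩) fun l w => hc l w
  · have hgram : (Matrix.gram ℝ v).det = 0 :=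
      not_not.1 fun h => hv (Matrix.linearIndependent_of_det_gram_ne_zero h)
    rw [det_of_apply_eq_zero_of_not_linearIndependent hv, hgram, abs_zero, Real.sqrt_zero, mul_zero]

end Gram

section MVFDeriv

variable {E : Type*} [NormedAddCommGroup E] [NormedSpace ℝ E] {H : Type*} [TopologicalSpace H]
  {I : ModelWithCorners ℝ E H} {M : Type*} [TopologicalSpace M] [ChartedSpace H M]
  {E' F : Type*} [NormedAddCommGroup E'] [NormedSpace ℝ E'] [NormedAddCommGroup F]
  [NormedSpace ℝ F]

theorem mvfderiv_eq_fderiv (f : E' → F) (x : E') : mvfderiv 𝓘(ℝ, E') f x = fderiv ℝ f x :=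
  mfderiv_eq_fderiv

theorem mvfderiv_comp_eq_fderiv {g : E' → F} {e : M → E'} {x : M}
    (hg : DifferentiableAt ℝ g (e x)) (he : MDifferentiableAt I 𝓘(ℝ, E') e x)
    (v : TangentSpace I x) :
    mvfderiv I (fun y => g (e y)) x v = fderiv ℝ g (e x) (mvfderiv I e x v) := by
  rw [← mvfderiv_eq_fderiv]
  exact mfderiv_comp_apply (I' := 𝓘(ℝ, E')) (I'' := 𝓘(ℝ, F)) x hg.mdifferentiableAt he v

theorem mvfderiv_mfderiv {g : M → F} {f : E' → M} {x : E'}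
    (hg : MDifferentiableAt I 𝓘(ℝ, F) g (f x)) (hf : MDifferentiableAt 𝓘(ℝ, E') I f x) (w : E') :
    mvfderiv I g (f x) (mfderiv 𝓘(ℝ, E') I f x w) = fderiv ℝ (fun y => g (f y)) x w := by
  rw [← mvfderiv_eq_fderiv]
  exact (mfderiv_comp_apply (I' := I) (I'' := 𝓘(ℝ, F)) x hg hf w).symm

theorem mvfderiv_congr {f g : M → F} {x : M} (h : f =ᶠ[𝓝 x] g) :
    mvfderiv I f x = mvfderiv I g x :=
  h.mfderiv_eq (I := I) (I' := 𝓘(ℝ, F))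

variable [RiemannianBundle (fun x : M => TangentSpace I x)]

section

attribute [local instance] normedAddCommGroupTangentSpaceVectorSpace
  normedSpaceTangentSpaceVectorSpace

theorem eventually_norm_mvfderiv_extChartAt_le [IsManifold I 1 M]
    [IsContinuousRiemannianBundle E (fun x : M => TangentSpace I x)] (x₀ : M) :
    ∃ C : ℝ, ∀ᶠ x in 𝓝 x₀, ∀ v : TangentSpace I x,
      ‖mvfderiv I (extChartAt I x₀) x v‖ ≤ C * ‖v‖ := by
  obtain ⟨C, -, hC⟩ := eventually_norm_mfderiv_extChartAt_lt I x₀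
  refine ⟨C, hC.mono fun x hx v => ?_⟩
  exact (ContinuousLinearMap.le_opNorm (mfderiv I 𝓘(ℝ, E) (extChartAt I x₀) x) v).trans
    (mul_le_mul_of_nonneg_right hx.le (norm_nonneg v))

end

variable [I.Boundaryless] [IsManifold I 1 M]
  [IsContinuousRiemannianBundle E (fun x : M => TangentSpace I x)]

theorem exists_eventually_norm_mvfderiv_le {f : M → F} (hf : ContMDiff I 𝓘(ℝ, F) 1 f) (x₀ : M) :
    ∃ C : ℝ, ∀ᶠ x in 𝓝 x₀, ∀ v : TangentSpace I x, ‖mvfderiv I f x v‖ ≤ C * ‖v‖ := by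
  let e := extChartAt I x₀
  let g : E → F := fun y => f (e.symm y)
  have hg : ContDiffOn ℝ 1 g e.target :=
    contMDiffOn_iff_contDiffOn.1 (hf.comp_contMDiffOn (contMDiffOn_extChartAt_symm x₀))
  have hopen : IsOpen e.target := isOpen_extChartAt_target x₀
  have hcont : ContinuousAt (fun x => ‖fderiv ℝ g (e x)‖) x₀ :=
    (ContinuousAt.comp (f := e) ((hg.continuousOn_fderiv_of_isOpen hopen le_rfl).continuousAt
      (hopen.mem_nhds (mem_extChartAt_target x₀))) (continuousAt_extChartAt x₀)).norm
  obtain ⟨C, hC⟩ := eventually_norm_mvfderiv_extChartAt_le (I := I) x₀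
  refine ⟨(‖fderiv ℝ g (e x₀)‖ + 1) * C, ?_⟩
  filter_upwards [hC, hcont.eventually_lt_const (lt_add_one _),
    extChartAt_source_mem_nhds (I := I) x₀] with x hxC hxg hx v
  have hfactor : f =ᶠ[𝓝 x] fun y => g (e y) := by
    filter_upwards [extChartAt_source_mem_nhds' (I := I) hx] with y hy
    exact congrArg f (e.left_inv hy).symm
  have hgx : DifferentiableAt ℝ g (e x) :=
    (hg.differentiableOn one_ne_zero).differentiableAt (hopen.mem_nhds (e.map_source hx))
  have hex : MDifferentiableAt I 𝓘(ℝ, E) e x :=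
    mdifferentiableAt_extChartAt (by rwa [← extChartAt_source I])
  rw [mvfderiv_congr hfactor, mvfderiv_comp_eq_fderiv hgx hex, mul_assoc]
  exact ((fderiv ℝ g (e x)).le_opNorm _).trans
    (mul_le_mul hxg.le (hxC v) (norm_nonneg _) (by positivity))

theorem exists_norm_mvfderiv_le [CompactSpace M] {f : M → F} (hf : ContMDiff I 𝓘(ℝ, F) 1 f) :
    ∃ C : ℝ, 0 ≤ C ∧ ∀ (x : M) (v : TangentSpace I x), ‖mvfderiv I f x v‖ ≤ C * ‖v‖ := by
  choose C hC using exists_eventually_norm_mvfderiv_le hf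
  obtain ⟨t, ht⟩ := CompactSpace.elim_nhds_subcover _ hC
  refine ⟨∑ y ∈ t, |C y|, Finset.sum_nonneg fun _ _ => abs_nonneg _, fun x v => ?_⟩
  obtain ⟨y, hy, hxy⟩ := mem_iUnion₂.1 (ht.ge (mem_univ x))
  refine (hxy v).trans (mul_le_mul_of_nonneg_right ((le_abs_self _).trans ?_) (norm_nonneg _))
  exact Finset.single_le_sum (f := fun y => |C y|) (fun _ _ => abs_nonneg _) hy

end MVFDeriv

section TangentBundle

variable {E : Type*} [NormedAddCommGroup E] [NormedSpace ℝ E] {H : Type*} [TopologicalSpace H]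
  {I : ModelWithCorners ℝ E H} {M : Type*} [TopologicalSpace M] [ChartedSpace H M]
  [IsManifold I 1 M] {E' : Type*} [NormedAddCommGroup E'] [NormedSpace ℝ E']

theorem continuousAt_tangentMap {f : E' → M} {x : E'} (hf : ContMDiffAt 𝓘(ℝ, E') I 1 f x)
    (v : TangentSpace 𝓘(ℝ, E') x) : ContinuousAt (tangentMap 𝓘(ℝ, E') I f) ⟨x, v⟩ := by
  obtain ⟨u, hu, hfu⟩ := (contMDiffAt_iff_contMDiffOn_nhds (by decide)).1 hf
  obtain ⟨t, htu, ht, hxt⟩ := mem_nhds_iff.1 hu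
  have hft : ContMDiffOn 𝓘(ℝ, E') I 1 f t := hfu.mono htu
  have hopen : IsOpen (Bundle.TotalSpace.proj ⁻¹' t : Set (TangentBundle 𝓘(ℝ, E') E')) :=
    ht.preimage (FiberBundle.continuous_proj E' (TangentSpace 𝓘(ℝ, E')))
  have hcont : ContinuousOn (tangentMap 𝓘(ℝ, E') I f) (Bundle.TotalSpace.proj ⁻¹' t) :=
    (hft.continuousOn_tangentMapWithin le_rfl ht.uniqueMDiffOn).congr fun p hp =>
      (tangentMapWithin_eq_tangentMap (ht.uniqueMDiffWithinAt hp)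
        ((hft.contMDiffAt (ht.mem_nhds hp)).mdifferentiableAt one_ne_zero)).symm
  exact hcont.continuousAt (hopen.mem_nhds hxt)

theorem continuousOn_mfderiv_apply {f : E' → M} {T : Type*} [TopologicalSpace T] {s : Set T}
    {p w : T → E'} (hf : ∀ t ∈ s, ContMDiffAt 𝓘(ℝ, E') I 1 f (p t)) (hp : ContinuousOn p s)
    (hw : ContinuousOn w s) :
    ContinuousOn (fun t => (⟨f (p t), mfderiv 𝓘(ℝ, E') I f (p t) (w t)⟩ : TangentBundle I M)) s :=
  fun t ht => (continuousAt_tangentMap (hf t ht) (w t)).comp_continuousWithinAt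
    (f := fun t => (⟨p t, w t⟩ : TangentBundle 𝓘(ℝ, E') E'))
    ((tangentBundleModelSpaceHomeomorph 𝓘(ℝ, E')).symm.continuous.comp_continuousOn
      (hp.prodMk hw) t ht)

end TangentBundle

theorem ofReal_abs_integral_le_mul_lintegral {X : Type*} [MeasurableSpace X] {μ : Measure X}
    {f g : X → ℝ} {c : ℝ} (hc : 0 ≤ c) (h : ∀ x, |f x| ≤ c * g x) :
    ENNReal.ofReal |∫ x, f x ∂μ| ≤ ENNReal.ofReal c * ∫⁻ x, ENNReal.ofReal (g x) ∂μ := by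
  rw [← Real.enorm_eq_ofReal_abs, ← lintegral_const_mul' _ _ ENNReal.ofReal_ne_top]
  refine (enorm_integral_le_lintegral_enorm f).trans (lintegral_mono fun x => ?_)
  dsimp only
  rw [Real.enorm_eq_ofReal_abs, ← ENNReal.ofReal_mul hc]
  exact ENNReal.ofReal_le_ofReal (h x)

namespace ImmersedDisk

variable {n k : ℕ} {M : Type*} [TopologicalSpace M] [ChartedSpace (EuclideanSpace ℝ (Fin n)) M]
  (D : ImmersedDisk n M k)

/-- The pull-back of `dg₁ ∧ … ∧ dg_k` to a boundary piece. -/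
noncomputable def wedgeDensity (g : Fin k → M → ℝ) (j : Fin D.numPieces) (u : Fin k → ℝ) : ℝ :=
  Matrix.det (Matrix.of fun i l =>
    mvfderiv (𝓡 n) (g l) (D.toFun (D.piece j u)) (D.boundaryVec j u i))

/-- The integral of `b dg₁ ∧ … ∧ dg_k` over the boundary. -/
noncomputable def wedgeIntegral (b : M → ℝ) (g : Fin k → M → ℝ) : ℝ :=
  ∑ j, ∫ u in unitCube k, b (D.toFun (D.piece j u)) * D.wedgeDensity g j u

theorem contDiffAt_comp {g : M → ℝ} (hg : ContMDiff (𝓡 n) 𝓘(ℝ, ℝ) 1 g) {x : Fin (k + 1) → ℝ}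
    (hx : x ∈ D.carrier) : ContDiffAt ℝ 1 (fun y => g (D.toFun y)) x :=
  (hg.contMDiffAt.comp x (D.contMDiffAt x hx)).contDiffAt

theorem mvfderiv_mfderiv_toFun {g : M → ℝ} (hg : ContMDiff (𝓡 n) 𝓘(ℝ, ℝ) 1 g)
    {x : Fin (k + 1) → ℝ} (hx : x ∈ D.carrier) (w : Fin (k + 1) → ℝ) :
    mvfderiv (𝓡 n) g (D.toFun x) (mfderiv 𝓘(ℝ, Fin (k + 1) → ℝ) (𝓡 n) D.toFun x w) =
      fderiv ℝ (fun y => g (D.toFun y)) x w :=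
  mvfderiv_mfderiv (hg.mdifferentiableAt one_ne_zero)
    ((D.contMDiffAt x hx).mdifferentiableAt one_ne_zero) w

theorem wedgeDensity_eq {g : Fin k → M → ℝ} (hg : ∀ l, ContMDiff (𝓡 n) 𝓘(ℝ, ℝ) 1 (g l))
    (j : Fin D.numPieces) {u : Fin k → ℝ} (hu : u ∈ unitCube k) :
    D.wedgeDensity g j u = Matrix.det (Matrix.of fun i l =>
      fderiv ℝ (fun y => g l (D.toFun y)) (D.piece j u) (D.pieceVec j u i)) := by
  rw [wedgeDensity]
  congr 1
  ext i l
  exact D.mvfderiv_mfderiv_toFun (hg l) (D.piece_mem_carrier j hu) _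

theorem continuousOn_toFun_piece (j : Fin D.numPieces) :
    ContinuousOn (fun u => D.toFun (D.piece j u)) (unitCube k) :=
  ContinuousOn.comp (fun x hx => (D.contMDiffAt x hx).continuousAt.continuousWithinAt)
    (D.continuousOn_piece j) fun _ hu => D.piece_mem_carrier j hu

theorem continuousOn_wedgeDensity {g : Fin k → M → ℝ}
    (hg : ∀ l, ContMDiff (𝓡 n) 𝓘(ℝ, ℝ) 1 (g l)) (j : Fin D.numPieces) :
    ContinuousOn (D.wedgeDensity g j) (unitCube k) := by
  have hfderiv : ∀ l, ContinuousOn (fderiv ℝ fun y => g l (D.toFun y)) D.carrier := fun l x hx =>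
    ((D.contDiffAt_comp (hg l) hx).continuousAt_fderiv one_ne_zero).continuousWithinAt
  refine ContinuousOn.congr (continuous_id.matrix_det.comp_continuousOn ?_)
    fun u hu => D.wedgeDensity_eq hg j hu
  exact continuousOn_pi.2 fun i => continuousOn_pi.2 fun l =>
    ((hfderiv l).comp (D.continuousOn_piece j) fun _ hu => D.piece_mem_carrier j hu).clm_apply
      (D.continuousOn_pieceVec j i)

theorem integrableOn_mul_wedgeDensity {b : M → ℝ} (hb : Continuous b) {g : Fin k → M → ℝ}
    (hg : ∀ l, ContMDiff (𝓡 n) 𝓘(ℝ, ℝ) 1 (g l)) (j : Fin D.numPieces) :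
    IntegrableOn (fun u => b (D.toFun (D.piece j u)) * D.wedgeDensity g j u) (unitCube k) :=
  ((hb.comp_continuousOn (D.continuousOn_toFun_piece j)).mul
    (D.continuousOn_wedgeDensity hg j)).integrableOn_compact isCompact_unitCube

theorem wedgeIntegral_sub {b c : M → ℝ} (hb : Continuous b) (hc : Continuous c)
    {g : Fin k → M → ℝ} (hg : ∀ l, ContMDiff (𝓡 n) 𝓘(ℝ, ℝ) 1 (g l)) :
    D.wedgeIntegral (fun x => b x - c x) g = D.wedgeIntegral b g - D.wedgeIntegral c g := by
  simp only [wedgeIntegral, sub_mul, ← Finset.sum_sub_distrib]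
  exact Finset.sum_congr rfl fun j _ => integral_sub
    (D.integrableOn_mul_wedgeDensity hb hg j) (D.integrableOn_mul_wedgeDensity hc hg j)

theorem wedgeIntegral_eq_integral_carrier {b : M → ℝ} (hb : ContMDiff (𝓡 n) 𝓘(ℝ, ℝ) 1 b)
    {g : Fin k → M → ℝ} (hg : ∀ l, ContMDiff (𝓡 n) 𝓘(ℝ, ℝ) 1 (g l)) :
    D.wedgeIntegral b g = ∫ x in D.carrier, Matrix.det (Matrix.of fun i l =>
      mvfderiv (𝓡 n) ((Fin.cons b g : Fin (k + 1) → M → ℝ) l) (D.toFun x)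
        (mfderiv 𝓘(ℝ, Fin (k + 1) → ℝ) (𝓡 n) D.toFun x
          (Pi.single i (1 : ℝ) : Fin (k + 1) → ℝ))) := by
  have hstokes := D.stokes (b := fun y => b (D.toFun y)) (g := fun l y => g l (D.toFun y))
    (fun x hx => D.contDiffAt_comp hb hx) (fun l x hx => D.contDiffAt_comp (hg l) hx)
  have hboundary : D.wedgeIntegral b g = ∑ j, ∫ u in unitCube k, b (D.toFun (D.piece j u)) *
      Matrix.det (Matrix.of fun i l =>
        fderiv ℝ (fun y => g l (D.toFun y)) (D.piece j u) (D.pieceVec j u i)) :=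
    Finset.sum_congr rfl fun j _ => setIntegral_congr_fun isCompact_unitCube.measurableSet
      fun u hu => congrArg _ (D.wedgeDensity_eq hg j hu)
  rw [hboundary, ← hstokes]
  refine setIntegral_congr_fun D.isCompact_carrier.measurableSet fun x hx => ?_
  rw [detCons_apply, ← Matrix.det_transpose]
  congr 1
  ext i l
  cases l using Fin.cases with
  | zero => exact (D.mvfderiv_mfderiv_toFun hb hx _).symm
  | succ l => exact (D.mvfderiv_mfderiv_toFun (hg l) hx _).symm

variable [RiemannianBundle (fun x : M => TangentSpace (𝓡 n) x)]

theorem continuousOn_gram_boundaryVec [IsManifold (𝓡 n) 1 M]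
    [IsContinuousRiemannianBundle (EuclideanSpace ℝ (Fin n)) (fun x : M => TangentSpace (𝓡 n) x)]
    (j : Fin D.numPieces) :
    ContinuousOn (fun u => Matrix.gram ℝ (D.boundaryVec j u)) (unitCube k) := by
  have hvec : ∀ i, ContinuousOn (fun u => (⟨D.toFun (D.piece j u), D.boundaryVec j u i⟩ :
      TangentBundle (𝓡 n) M)) (unitCube k) := fun i =>
    continuousOn_mfderiv_apply (fun u hu => D.contMDiffAt _ (D.piece_mem_carrier j hu))
      (D.continuousOn_piece j) (D.continuousOn_pieceVec j i)
  exact continuousOn_pi.2 fun i => continuousOn_pi.2 fun l => (hvec i).inner_bundle (hvec l)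

theorem boundaryVol_ne_top [IsManifold (𝓡 n) 1 M]
    [IsContinuousRiemannianBundle (EuclideanSpace ℝ (Fin n)) (fun x : M => TangentSpace (𝓡 n) x)] :
    D.boundaryVol ≠ ⊤ :=
  ENNReal.sum_ne_top.2 fun j _ =>
    have hsqrt : IntegrableOn (fun u => √(Matrix.gram ℝ (D.boundaryVec j u)).det) (unitCube k) :=
      (continuous_id.matrix_det.sqrt.comp_continuousOn
        (D.continuousOn_gram_boundaryVec j)).integrableOn_compact isCompact_unitCube
    hsqrt.lintegral_lt_top.ne

theorem ofReal_abs_wedgeIntegral_le_boundaryVol {b : M → ℝ} {g : Fin k → M → ℝ} {C δ : ℝ}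
    (hC0 : 0 ≤ C) (hC : ∀ l x (v : TangentSpace (𝓡 n) x), |mvfderiv (𝓡 n) (g l) x v| ≤ C * ‖v‖)
    (hδ : ∀ x, |b x| ≤ δ) :
    ENNReal.ofReal |D.wedgeIntegral b g| ≤
      ENNReal.ofReal (δ * (k.factorial * C ^ k)) * D.boundaryVol := by
  have hδ0 : 0 ≤ δ := (abs_nonneg _).trans (hδ (D.toFun 0))
  have hdensity : ∀ j u, |D.wedgeDensity g j u| ≤
      k.factorial * C ^ k * √(Matrix.gram ℝ (D.boundaryVec j u)).det := fun j u => by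
    refine (abs_det_le_sqrt_det_gram (fun l => (mvfderiv (𝓡 n) (g l) _).toLinearMap)
      (D.boundaryVec j u) fun l v => hC l _ v).trans_eq ?_
    rw [Fintype.card_fin, Finset.prod_const, Finset.card_univ, Fintype.card_fin]
  calc ENNReal.ofReal |D.wedgeIntegral b g|
      ≤ ∑ j, ENNReal.ofReal |∫ u in unitCube k,
          b (D.toFun (D.piece j u)) * D.wedgeDensity g j u| := by
        rw [← ENNReal.ofReal_sum_of_nonneg fun _ _ => abs_nonneg _]
        exact ENNReal.ofReal_le_ofReal (Finset.abs_sum_le_sum_abs _ _)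
    _ ≤ ENNReal.ofReal (δ * (k.factorial * C ^ k)) * D.boundaryVol := by
        rw [boundaryVol, Finset.mul_sum]
        refine Finset.sum_le_sum fun j _ =>
          ofReal_abs_integral_le_mul_lintegral (by positivity) fun u => ?_
        rw [abs_mul, mul_assoc]
        exact mul_le_mul (hδ _) (hdensity j u) (abs_nonneg _) hδ0

theorem ofReal_abs_wedgeIntegral_le_vol {b : M → ℝ} (hb : ContMDiff (𝓡 n) 𝓘(ℝ, ℝ) 1 b)
    {g : Fin k → M → ℝ} (hg : ∀ l, ContMDiff (𝓡 n) 𝓘(ℝ, ℝ) 1 (g l)) {C Cb : ℝ} (hC0 : 0 ≤ C)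
    (hCb0 : 0 ≤ Cb)
    (hC : ∀ l x (v : TangentSpace (𝓡 n) x), |mvfderiv (𝓡 n) (g l) x v| ≤ C * ‖v‖)
    (hCb : ∀ x (v : TangentSpace (𝓡 n) x), |mvfderiv (𝓡 n) b x v| ≤ Cb * ‖v‖) :
    ENNReal.ofReal |D.wedgeIntegral b g| ≤
      ENNReal.ofReal (Cb * ((k + 1).factorial * C ^ k)) * D.vol := by
  have hcons : ∀ l x (v : TangentSpace (𝓡 n) x),
      |mvfderiv (𝓡 n) ((Fin.cons b g : Fin (k + 1) → M → ℝ) l) x v| ≤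
        (Fin.cons Cb fun _ => C : Fin (k + 1) → ℝ) l * ‖v‖ := fun l x v => by
    cases l using Fin.cases with
    | zero => exact hCb x v
    | succ l => exact hC l x v
  rw [D.wedgeIntegral_eq_integral_carrier hb hg, vol]
  refine ofReal_abs_integral_le_mul_lintegral (by positivity) fun x => ?_
  refine (abs_det_le_sqrt_det_gram (fun l => (mvfderiv (𝓡 n) _ (D.toFun x)).toLinearMap) _
    fun l v => hcons l _ v).trans_eq ?_
  rw [Fin.prod_univ_succ]
  simp only [Fin.cons_zero, Fin.cons_succ, Finset.prod_const, Finset.card_univ, Fintype.card_fin]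
  ring

end ImmersedDisk

section Coefficients

theorem alternatingMap_eq_sum_mul_det {n k : ℕ}
    (β : (EuclideanSpace ℝ (Fin n)) [⋀^Fin k]→ₗ[ℝ] ℝ) (ξ : Fin k → EuclideanSpace ℝ (Fin n)) :
    β ξ = ∑ I : Fin k ↪o Fin n, β (fun i => EuclideanSpace.single (I i) (1 : ℝ)) *
      Matrix.det (Matrix.of fun i l => ξ i (I l)) := by
  let b := (EuclideanSpace.basisFun (Fin n) ℝ).toBasis
  let f := exteriorPower.alternatingMapLinearEquiv β
  have hf : ∀ η, f (exteriorPower.ιMulti ℝ k η) = β η :=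
    exteriorPower.alternatingMapLinearEquiv_apply_ιMulti β
  rw [← hf ξ, ← (b.exteriorPower k).sum_repr (exteriorPower.ιMulti ℝ k ξ), map_sum,
    ← Set.powersetCard.ofFinEmbEquiv.sum_comp]
  refine Finset.sum_congr rfl fun I _ => ?_
  rw [map_smul, smul_eq_mul, mul_comm, exteriorPower.basis_apply,
    exteriorPower.ιMulti_family, hf, ← Module.Basis.coord_apply, exteriorPower.basis_coord,
    exteriorPower.ιMultiDual_apply_ιMulti, Equiv.symm_apply_apply]
  congr 2
  ext i
  simp only [b, Function.comp_apply, OrthonormalBasis.coe_toBasis, EuclideanSpace.basisFun_apply]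

variable {n k : ℕ} {M : Type*} [TopologicalSpace M] [ChartedSpace (EuclideanSpace ℝ (Fin n)) M]
  {φ : OpenPartialHomeomorph M (EuclideanSpace ℝ (Fin n))}

theorem mdifferentiable_of_mem_maximalAtlas (hφ : φ ∈ IsManifold.maximalAtlas (𝓡 n) ∞ M) :
    φ.MDifferentiable (𝓡 n) (𝓡 n) :=
  ⟨(contMDiffOn_of_mem_maximalAtlas hφ).mdifferentiableOn (by simp),
    (contMDiffOn_symm_of_mem_maximalAtlas hφ).mdifferentiableOn (by simp)⟩

theorem DiffForm.apply_eq_sum_coeff (α : DiffForm n M k)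
    (hφ : φ ∈ IsManifold.maximalAtlas (𝓡 n) ∞ M) {x : M} (hx : x ∈ φ.source)
    (v : Fin k → TangentSpace (𝓡 n) x) :
    α x v = ∑ I : Fin k ↪o Fin n, α.coeff φ I (φ x) *
      Matrix.det (Matrix.of fun i l => mvfderiv (𝓡 n) (fun z => φ z (I l)) x (v i)) := by
  have hd := mdifferentiable_of_mem_maximalAtlas hφ
  obtain ⟨y, hy, rfl⟩ : ∃ y ∈ φ.target, φ.symm y = x := ⟨φ x, φ.map_source hx, φ.left_inv hx⟩
  let L : EuclideanSpace ℝ (Fin n) →ₗ[ℝ] TangentSpace (𝓡 n) (φ.symm y) :=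
    (mfderiv (𝓡 n) (𝓡 n) φ.symm y).toLinearMap
  let ξ : Fin k → EuclideanSpace ℝ (Fin n) := fun i => mfderiv (𝓡 n) (𝓡 n) φ (φ.symm y) (v i)
  have hL : (fun i => L (ξ i)) = v := by
    have hinv := hd.symm_comp_deriv hx
    rw [φ.right_inv hy] at hinv
    exact funext fun i => DFunLike.congr_fun hinv (v i)
  have hξ : ∀ i l, ξ i l = mvfderiv (𝓡 n) (fun z => φ z l) (φ.symm y) (v i) := fun i l => by
    have hproj := mvfderiv_comp_eq_fderiv (g := EuclideanSpace.proj (𝕜 := ℝ) l) (e := φ)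
      (EuclideanSpace.proj (𝕜 := ℝ) l).differentiableAt (hd.mdifferentiableAt hx) (v i)
    rw [ContinuousLinearMap.fderiv] at hproj
    exact hproj.symm
  have hexpand := alternatingMap_eq_sum_mul_det
    ((α (φ.symm y)).toAlternatingMap.compLinearMap L) ξ
  simp only [hξ] at hexpand
  rw [φ.right_inv hy]
  exact (congrArg (α (φ.symm y)) hL.symm).trans hexpand

end Coefficients

section Holder

variable {X : Type*} {θ : ℝ≥0} {s : Set X} {f : X → ℝ}

theorem abs_le_toReal_holderNormOn [PseudoEMetricSpace X] (h : holderNormOn θ s f ≠ ⊤) {x : X}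
    (hx : x ∈ s) : |f x| ≤ (holderNormOn θ s f).toReal := by
  rw [← Real.norm_eq_abs, ← toReal_enorm]
  exact ENNReal.toReal_mono h
    ((le_iSup₂ (f := fun x (_ : x ∈ s) => ‖f x‖ₑ) x hx).trans le_self_add)

theorem memHolder_of_holderNormOn_ne_top [PseudoEMetricSpace X] (h : holderNormOn θ s f ≠ ⊤) :
    MemHolder θ (fun x : s => f x) :=
  eHolderNorm_ne_top.1 (ne_top_of_le_ne_top h le_add_self)

variable [MetricSpace X]

theorem abs_sub_le_toReal_holderNormOn (h : holderNormOn θ s f ≠ ⊤) {x y : X} (hx : x ∈ s)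
    (hy : y ∈ s) : |f x - f y| ≤ (holderNormOn θ s f).toReal * dist x y ^ (θ : ℝ) := by
  have hdist := (memHolder_of_holderNormOn_ne_top h).holderWith.dist_le ⟨x, hx⟩ ⟨y, hy⟩
  rw [Real.dist_eq, Subtype.dist_eq] at hdist
  refine hdist.trans (mul_le_mul_of_nonneg_right ?_ (by positivity))
  exact ENNReal.toReal_mono h le_add_self

theorem continuousOn_of_holderNormOn_ne_top (hθ : 0 < θ) (h : holderNormOn θ s f ≠ ⊤) :
    ContinuousOn f s :=
  continuousOn_iff_continuous_domRestrict.2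
    ((memHolder_of_holderNormOn_ne_top h).holderWith.continuous hθ)

end Holder

section Interpolation

variable {Z N P V : ℝ≥0∞} {θ : ℝ}

theorem eq_zero_of_forall_le_ofReal_rpow_mul (hθ : 0 < θ) (hP : P ≠ ⊤)
    (hZ : ∀ ε : ℝ, 0 < ε → ε ≤ 1 → Z ≤ ENNReal.ofReal (ε ^ θ) * P) : Z = 0 := by
  have hrpow : Filter.Tendsto (fun ε : ℝ => ε ^ θ) (𝓝[>] 0) (𝓝 0) := by
    simpa only [Real.zero_rpow hθ.ne'] using
      (Real.continuousAt_rpow_const 0 θ (Or.inr hθ.le)).tendsto.mono_left nhdsWithin_le_nhds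
  have hlim : Filter.Tendsto (fun ε : ℝ => ENNReal.ofReal (ε ^ θ) * P) (𝓝[>] 0) (𝓝 0) := by
    simpa only [ENNReal.ofReal_zero, zero_mul] using
      ENNReal.Tendsto.mul_const (ENNReal.tendsto_ofReal hrpow) (Or.inr hP)
  refine le_zero_iff.1 (ge_of_tendsto hlim ?_)
  filter_upwards [self_mem_nhdsWithin, nhdsWithin_le_nhds (eventually_le_nhds zero_lt_one)]
    with ε hε hε1 using hZ ε hε hε1

theorem rpow_div_mul_self {p v : ℝ} (hp : 0 < p) (hv : 0 ≤ v) (θ : ℝ) :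
    (v / p) ^ θ * p = p ^ (1 - θ) * v ^ θ := by
  rw [Real.div_rpow hv hp.le, Real.rpow_sub hp, Real.rpow_one]
  ring

theorem rpow_sub_one_div_mul_self {p v : ℝ} (hp : 0 < p) (hv : 0 < v) (θ : ℝ) :
    (v / p) ^ (θ - 1) * v = p ^ (1 - θ) * v ^ θ := by
  rw [Real.rpow_sub_one (div_pos hv hp).ne', ← rpow_div_mul_self hp hv.le]
  field_simp

theorem le_rpow_mul_rpow_of_forall_le (hθ₀ : 0 < θ) (hθ₁ : θ ≤ 1) (hN : N ≠ ⊤) (hP : P ≠ ⊤)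
    (hZP : Z ≤ N * P)
    (hZ : ∀ ε : ℝ, 0 < ε → ε ≤ 1 →
      Z ≤ N * (ENNReal.ofReal (ε ^ θ) * P + ENNReal.ofReal (ε ^ (θ - 1)) * V)) :
    Z ≤ 2 * N * P ^ (1 - θ) * V ^ θ := by
  rcases le_or_gt P V with hPV | hVP
  · calc Z ≤ N * P := hZP
      _ = N * (P ^ (1 - θ) * P ^ θ) := by
        rw [← ENNReal.rpow_add_of_nonneg _ _ (sub_nonneg.2 hθ₁) hθ₀.le, sub_add_cancel,
          ENNReal.rpow_one]
      _ ≤ N * (P ^ (1 - θ) * V ^ θ) := by gcongr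
      _ ≤ 2 * (N * (P ^ (1 - θ) * V ^ θ)) := le_mul_of_one_le_left' one_le_two
      _ = 2 * N * P ^ (1 - θ) * V ^ θ := by ring
  · lift P to ℝ≥0 using hP
    lift V to ℝ≥0 using hVP.ne_top
    have hP0 : 0 < (P : ℝ) := V.coe_nonneg.trans_lt (by exact_mod_cast hVP)
    rcases eq_zero_or_pos V with rfl | hV0
    · have hZ0 : Z = 0 := eq_zero_of_forall_le_ofReal_rpow_mul hθ₀
        (ENNReal.mul_ne_top hN ENNReal.coe_ne_top) fun ε hε hε1 => by
          simpa only [ENNReal.coe_zero, mul_zero, add_zero, mul_left_comm] using hZ ε hε hε1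
      exact hZ0.trans_le zero_le
    · have hV0' : 0 < (V : ℝ) := hV0
      have hVP' : (V : ℝ) / P ≤ 1 := (div_le_one hP0).2 (by exact_mod_cast hVP.le)
      -- `ε = V / P` balances the two terms.
      refine (hZ (V / P) (div_pos hV0' hP0) hVP').trans_eq ?_
      rw [← ENNReal.ofReal_coe_nnreal (p := P), ← ENNReal.ofReal_coe_nnreal (p := V),
        ← ENNReal.ofReal_mul (by positivity), ← ENNReal.ofReal_mul (by positivity),
        rpow_div_mul_self hP0 hV0'.le, rpow_sub_one_div_mul_self hP0 hV0',
        ENNReal.ofReal_rpow_of_pos hP0, ENNReal.ofReal_rpow_of_pos hV0',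
        ENNReal.ofReal_mul (by positivity)]
      ring

end Interpolation

section LocalizedChart

variable {n k : ℕ} {M : Type*} [TopologicalSpace M] [ChartedSpace (EuclideanSpace ℝ (Fin n)) M]
  {φ : OpenPartialHomeomorph M (EuclideanSpace ℝ (Fin n))}

/-- A `C^1` cutoff function supported in the domain of the chart `φ`, together with a `C^1` map
defined on all of `M` that agrees with `φ` near the support. It makes the coordinate functions of
`φ` available as global functions, as the boundary integrals of this file require. -/
structure LocalizedChart (φ : OpenPartialHomeomorph M (EuclideanSpace ℝ (Fin n))) where
  cutoff : M → ℝ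
  coord : M → EuclideanSpace ℝ (Fin n)
  contMDiff_cutoff : ContMDiff (𝓡 n) 𝓘(ℝ, ℝ) 1 cutoff
  abs_cutoff_le_one : ∀ x, |cutoff x| ≤ 1
  tsupport_cutoff_subset : tsupport cutoff ⊆ φ.source
  contMDiff_coord : ContMDiff (𝓡 n) (𝓡 n) 1 coord
  coord_eventuallyEq : ∀ x ∈ tsupport cutoff, coord =ᶠ[𝓝 x] φ

theorem exists_contMDiff_eventuallyEq_chart [T2Space M] [CompactSpace M] [IsManifold (𝓡 n) ∞ M]
    (hφ : φ ∈ IsManifold.maximalAtlas (𝓡 n) ∞ M) {s : Set M} (hs : IsClosed s)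
    (hsφ : s ⊆ φ.source) :
    ∃ X : M → EuclideanSpace ℝ (Fin n), ContMDiff (𝓡 n) (𝓡 n) ∞ X ∧ ∀ x ∈ s, X =ᶠ[𝓝 x] φ := by
  have : LocallyCompactSpace M := ChartedSpace.locallyCompactSpace (EuclideanSpace ℝ (Fin n)) M
  obtain ⟨t, ht, hst, htφ⟩ := exists_compact_between hs.isCompact φ.open_source hsφ
  obtain ⟨η, hη1, hη0, -⟩ := exists_contMDiffMap_one_nhds_of_subset_interior (n := (⊤ : ℕ∞))
    (𝓡 n) hs hst
  refine ⟨fun x => η x • φ x, fun x => ?_, fun x hx => ?_⟩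
  · by_cases hx : x ∈ φ.source
    · exact η.contMDiff.contMDiffAt.smul
        ((contMDiffOn_of_mem_maximalAtlas hφ).contMDiffAt (φ.open_source.mem_nhds hx))
    · have hzero : (fun x => η x • φ x) =ᶠ[𝓝 x] fun _ => 0 := by
        filter_upwards [ht.isClosed.isOpen_compl.mem_nhds fun h => hx (htφ h)] with y hy
        rw [hη0 y hy, zero_smul]
      exact contMDiffAt_const.congr_of_eventuallyEq hzero
  · filter_upwards [Filter.Eventually.filter_mono (nhds_le_nhdsSet hx) hη1] with y hy
    rw [hy, one_smul]

theorem exists_localizedChart_sum_cutoff_eq_one [T2Space M] [CompactSpace M]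
    [IsManifold (𝓡 n) ∞ M] {ι : Type*} [Fintype ι]
    {φ : ι → OpenPartialHomeomorph M (EuclideanSpace ℝ (Fin n))}
    (hφ : ∀ i, φ i ∈ IsManifold.maximalAtlas (𝓡 n) ∞ M) (hcover : ∀ x, ∃ i, x ∈ (φ i).source) :
    ∃ L : ∀ i, LocalizedChart (φ i), ∀ x, ∑ i, (L i).cutoff x = 1 := by
  obtain ⟨χ, hχ⟩ := SmoothPartitionOfUnity.exists_isSubordinate (𝓡 n) (isClosed_univ (X := M))
    (fun i => (φ i).source) (fun i => (φ i).open_source) fun x _ => mem_iUnion.2 (hcover x)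
  choose X hX hXφ using fun i =>
    exists_contMDiff_eventuallyEq_chart (hφ i) (isClosed_tsupport (χ i)) (hχ i)
  refine ⟨fun i =>
    { cutoff := χ i
      coord := X i
      contMDiff_cutoff := (χ i).contMDiff.of_le (by simp)
      abs_cutoff_le_one := fun x => (abs_of_nonneg (χ.nonneg i x)).trans_le (χ.le_one i x)
      tsupport_cutoff_subset := hχ i
      contMDiff_coord := (hX i).of_le (by simp)
      coord_eventuallyEq := hXφ i }, fun x => ?_⟩
  rw [← finsum_eq_sum_of_fintype]
  exact χ.sum_eq_one (mem_univ x)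

namespace LocalizedChart

variable (L : LocalizedChart φ)

/-- The pullback under `φ` of a function on the target of `φ`, multiplied by the cutoff function
and extended by zero to `M`. -/
noncomputable def pullback (a : EuclideanSpace ℝ (Fin n) → ℝ) (x : M) : ℝ :=
  L.cutoff x * a (L.coord x)

theorem pullback_of_notMem_tsupport (a : EuclideanSpace ℝ (Fin n) → ℝ) {x : M}
    (hx : x ∉ tsupport L.cutoff) : L.pullback a x = 0 := by
  rw [pullback, image_eq_zero_of_notMem_tsupport hx, zero_mul]

theorem coord_mem_target {x : M} (hx : x ∈ tsupport L.cutoff) : L.coord x ∈ φ.target := by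
  rw [(L.coord_eventuallyEq x hx).eq_of_nhds]
  exact φ.map_source (L.tsupport_cutoff_subset hx)

theorem abs_pullback_le {a : EuclideanSpace ℝ (Fin n) → ℝ} {δ : ℝ} (hδ : 0 ≤ δ)
    (ha : ∀ y ∈ φ.target, |a y| ≤ δ) (x : M) : |L.pullback a x| ≤ δ := by
  by_cases hx : x ∈ tsupport L.cutoff
  · rw [pullback, abs_mul, ← one_mul δ]
    exact mul_le_mul (L.abs_cutoff_le_one x) (ha _ (L.coord_mem_target hx)) (abs_nonneg _)
      zero_le_one
  · rwa [L.pullback_of_notMem_tsupport a hx, abs_zero]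

theorem continuous_pullback {a : EuclideanSpace ℝ (Fin n) → ℝ} (ha : ContinuousOn a φ.target) :
    Continuous (L.pullback a) := by
  refine continuous_iff_continuousAt.2 fun x => ?_
  by_cases hx : x ∈ tsupport L.cutoff
  · exact L.contMDiff_cutoff.continuous.continuousAt.mul (ContinuousAt.comp (f := L.coord)
      (ha.continuousAt (φ.open_target.mem_nhds (L.coord_mem_target hx)))
      L.contMDiff_coord.continuous.continuousAt)
  · refine continuousAt_const.congr (f := fun _ => 0) ?_
    filter_upwards [(isClosed_tsupport L.cutoff).isOpen_compl.mem_nhds hx] with y hy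
    exact (L.pullback_of_notMem_tsupport a hy).symm

theorem contMDiff_pullback {a : EuclideanSpace ℝ (Fin n) → ℝ} (ha : ContDiff ℝ 1 a) :
    ContMDiff (𝓡 n) 𝓘(ℝ, ℝ) 1 (L.pullback a) :=
  L.contMDiff_cutoff.mul (ha.contMDiff.comp L.contMDiff_coord)

theorem contMDiff_coord_apply (l : Fin n) :
    ContMDiff (𝓡 n) 𝓘(ℝ, ℝ) 1 fun x => L.coord x l :=
  (EuclideanSpace.proj (𝕜 := ℝ) l).contDiff.contMDiff.comp L.contMDiff_coord

end LocalizedChart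

section Decomposition

variable {ι : Type*} [Fintype ι] {φ : ι → OpenPartialHomeomorph M (EuclideanSpace ℝ (Fin n))}

theorem DiffForm.apply_eq_sum_pullback_coeff (α : DiffForm n M k)
    (hφ : ∀ i, φ i ∈ IsManifold.maximalAtlas (𝓡 n) ∞ M) (L : ∀ i, LocalizedChart (φ i))
    (hL : ∀ x, ∑ i, (L i).cutoff x = 1) (x : M) (v : Fin k → TangentSpace (𝓡 n) x) :
    α x v = ∑ i, ∑ I : Fin k ↪o Fin n, (L i).pullback (α.coeff (φ i) I) x *
      Matrix.det (Matrix.of fun p l => mvfderiv (𝓡 n) (fun z => (L i).coord z (I l)) x (v p)) := by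
  rw [← one_mul (α x v), ← hL x, Finset.sum_mul]
  refine Finset.sum_congr rfl fun i _ => ?_
  by_cases hx : x ∈ tsupport (L i).cutoff
  · have hcoord := (L i).coord_eventuallyEq x hx
    have hderiv : ∀ l, mvfderiv (𝓡 n) (fun z => (L i).coord z l) x =
        mvfderiv (𝓡 n) (fun z => φ i z l) x := fun l =>
      mvfderiv_congr (hcoord.mono fun _ hy => congrArg (fun z => z.ofLp l) hy)
    rw [α.apply_eq_sum_coeff (hφ i) ((L i).tsupport_cutoff_subset hx) v, Finset.mul_sum]
    simp only [LocalizedChart.pullback, hderiv, hcoord.eq_of_nhds, mul_assoc]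
  · simp only [image_eq_zero_of_notMem_tsupport hx, (L i).pullback_of_notMem_tsupport _ hx,
      zero_mul, Finset.sum_const_zero]

theorem ImmersedDisk.boundaryIntegral_eq_sum_wedgeIntegral (D : ImmersedDisk n M k)
    (α : DiffForm n M k) (hφ : ∀ i, φ i ∈ IsManifold.maximalAtlas (𝓡 n) ∞ M)
    (L : ∀ i, LocalizedChart (φ i)) (hL : ∀ x, ∑ i, (L i).cutoff x = 1)
    (hα : ∀ i (I : Fin k ↪o Fin n), ContinuousOn (α.coeff (φ i) I) (φ i).target) :
    D.boundaryIntegral α = ∑ i, ∑ I : Fin k ↪o Fin n,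
      D.wedgeIntegral ((L i).pullback (α.coeff (φ i) I)) fun l x => (L i).coord x (I l) := by
  have hint : ∀ j i (I : Fin k ↪o Fin n), IntegrableOn (fun u =>
      (L i).pullback (α.coeff (φ i) I) (D.toFun (D.piece j u)) *
        D.wedgeDensity (fun l x => (L i).coord x (I l)) j u) (unitCube k) := fun j i I =>
    D.integrableOn_mul_wedgeDensity ((L i).continuous_pullback (hα i I))
      (fun l => (L i).contMDiff_coord_apply (I l)) j
  have hpiece : ∀ j, ∫ u in unitCube k, α (D.toFun (D.piece j u)) (D.boundaryVec j u) =
      ∑ i, ∑ I : Fin k ↪o Fin n, ∫ u in unitCube k,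
        (L i).pullback (α.coeff (φ i) I) (D.toFun (D.piece j u)) *
          D.wedgeDensity (fun l x => (L i).coord x (I l)) j u := fun j => by
    simp_rw [α.apply_eq_sum_pullback_coeff hφ L hL]
    refine (integral_finsetSum _ fun i _ => integrable_finsetSum _ fun I _ => hint j i I).trans ?_
    exact Finset.sum_congr rfl fun i _ => integral_finsetSum _ fun I _ => hint j i I
  rw [boundaryIntegral, Finset.sum_congr rfl fun j _ => hpiece j, Finset.sum_comm]
  refine Finset.sum_congr rfl fun i _ => ?_
  rw [Finset.sum_comm]
  rfl

end Decomposition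

namespace LocalizedChart

variable [RiemannianBundle (fun x : M => TangentSpace (𝓡 n) x)] (L : LocalizedChart φ) {C : ℝ}

theorem abs_mvfderiv_coord_apply_le
    (hC : ∀ x (v : TangentSpace (𝓡 n) x), ‖mvfderiv (𝓡 n) L.coord x v‖ ≤ C * ‖v‖) (l : Fin n)
    (x : M) (v : TangentSpace (𝓡 n) x) :
    |mvfderiv (𝓡 n) (fun z => L.coord z l) x v| ≤ C * ‖v‖ := by
  have hproj := mvfderiv_comp_eq_fderiv (g := EuclideanSpace.proj (𝕜 := ℝ) l) (e := L.coord)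
    (EuclideanSpace.proj (𝕜 := ℝ) l).differentiableAt
    (L.contMDiff_coord.mdifferentiableAt one_ne_zero) v
  rw [ContinuousLinearMap.fderiv] at hproj
  exact (congrArg abs hproj).trans_le ((PiLp.norm_apply_le _ l).trans (hC x v))

theorem abs_mvfderiv_pullback_le {H Λ : ℝ} {F : EuclideanSpace ℝ (Fin n) → ℝ}
    (hC₀ : ∀ x (v : TangentSpace (𝓡 n) x), |mvfderiv (𝓡 n) L.cutoff x v| ≤ C * ‖v‖)
    (hC₁ : ∀ x (v : TangentSpace (𝓡 n) x), ‖mvfderiv (𝓡 n) L.coord x v‖ ≤ C * ‖v‖)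
    (hF : Differentiable ℝ F) (hFH : ∀ y, |F y| ≤ H) (hFΛ : ∀ y, ‖fderiv ℝ F y‖ ≤ Λ) (x : M)
    (v : TangentSpace (𝓡 n) x) :
    |mvfderiv (𝓡 n) (L.pullback F) x v| ≤ (Λ * C + H * C) * ‖v‖ := by
  have hX : MDifferentiableAt (𝓡 n) (𝓡 n) L.coord x :=
    L.contMDiff_coord.mdifferentiableAt one_ne_zero
  have hproduct : mvfderiv (𝓡 n) (L.pullback F) x v =
      L.cutoff x * fderiv ℝ F (L.coord x) (mvfderiv (𝓡 n) L.coord x v) +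
        F (L.coord x) * mvfderiv (𝓡 n) L.cutoff x v := by
    rw [← mvfderiv_comp_eq_fderiv (hF _) hX]
    exact DFunLike.congr_fun (mvfderiv_fun_mul (L.contMDiff_cutoff.mdifferentiableAt one_ne_zero)
      ((hF _).mdifferentiableAt.comp x hX)) v
  have hfderiv : |fderiv ℝ F (L.coord x) (mvfderiv (𝓡 n) L.coord x v)| ≤ Λ * (C * ‖v‖) :=
    (fderiv ℝ F (L.coord x)).le_of_opNorm_le_of_le (hFΛ _) (hC₁ x v)
  calc |mvfderiv (𝓡 n) (L.pullback F) x v|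
      ≤ |L.cutoff x| * |fderiv ℝ F (L.coord x) (mvfderiv (𝓡 n) L.coord x v)| +
          |F (L.coord x)| * |mvfderiv (𝓡 n) L.cutoff x v| := by
        rw [hproduct, ← abs_mul, ← abs_mul]
        exact abs_add_le _ _
    _ ≤ 1 * (Λ * (C * ‖v‖)) + H * (C * ‖v‖) :=
        add_le_add (mul_le_mul (L.abs_cutoff_le_one x) hfderiv (abs_nonneg _) zero_le_one)
          (mul_le_mul (hFH _) (hC₀ x v) (abs_nonneg _) ((abs_nonneg _).trans (hFH 0)))
    _ = (Λ * C + H * C) * ‖v‖ := by ring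

theorem exists_norm_mvfderiv_cutoff_le_and_coord_le [CompactSpace M] [IsManifold (𝓡 n) 1 M]
    [IsContinuousRiemannianBundle (EuclideanSpace ℝ (Fin n)) (fun x : M => TangentSpace (𝓡 n) x)] :
    ∃ C : ℝ, 0 ≤ C ∧ (∀ x (v : TangentSpace (𝓡 n) x), |mvfderiv (𝓡 n) L.cutoff x v| ≤ C * ‖v‖) ∧
      ∀ x (v : TangentSpace (𝓡 n) x), ‖mvfderiv (𝓡 n) L.coord x v‖ ≤ C * ‖v‖ := by
  obtain ⟨c, hc0, hc⟩ := exists_norm_mvfderiv_le L.contMDiff_cutoff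
  obtain ⟨d, -, hd⟩ := exists_norm_mvfderiv_le L.contMDiff_coord
  refine ⟨max c d, le_max_of_le_left hc0, fun x v => (hc x v).trans ?_,
    fun x v => (hd x v).trans ?_⟩
  · gcongr
    exact le_max_left c d
  · gcongr
    exact le_max_right c d

variable (D : ImmersedDisk n M k)

theorem ofReal_abs_wedgeIntegral_le_boundaryVol {a : EuclideanSpace ℝ (Fin n) → ℝ} {δ : ℝ}
    (hC0 : 0 ≤ C) (hC : ∀ x (v : TangentSpace (𝓡 n) x), ‖mvfderiv (𝓡 n) L.coord x v‖ ≤ C * ‖v‖)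
    (hδ : 0 ≤ δ) (ha : ∀ y ∈ φ.target, |a y| ≤ δ) (I : Fin k → Fin n) :
    ENNReal.ofReal |D.wedgeIntegral (L.pullback a) fun l x => L.coord x (I l)| ≤
      ENNReal.ofReal (δ * (k.factorial * C ^ k)) * D.boundaryVol :=
  D.ofReal_abs_wedgeIntegral_le_boundaryVol hC0 (fun l => L.abs_mvfderiv_coord_apply_le hC (I l))
    (L.abs_pullback_le hδ ha)

/-- The coefficient is replaced by its approximation at scale `ε`: the error is integrated over
`∂D`, and Stokes' theorem turns the integral of the approximation into one over `D`. -/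
theorem ofReal_abs_wedgeIntegral_le_of_holder {a : EuclideanSpace ℝ (Fin n) → ℝ} {H θ ε : ℝ}
    (hC0 : 0 ≤ C)
    (hC₀ : ∀ x (v : TangentSpace (𝓡 n) x), |mvfderiv (𝓡 n) L.cutoff x v| ≤ C * ‖v‖)
    (hC₁ : ∀ x (v : TangentSpace (𝓡 n) x), ‖mvfderiv (𝓡 n) L.coord x v‖ ≤ C * ‖v‖)
    (hH : 0 ≤ H) (hθ₀ : 0 < θ) (hθ₁ : θ ≤ 1) (hε : 0 < ε)
    (ha : ∀ y ∈ φ.target, |a y| ≤ H)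
    (haθ : ∀ y ∈ φ.target, ∀ z ∈ φ.target, |a y - a z| ≤ H * dist y z ^ θ)
    (hac : ContinuousOn a φ.target) (I : Fin k → Fin n) :
    ENNReal.ofReal |D.wedgeIntegral (L.pullback a) fun l x => L.coord x (I l)| ≤
      ENNReal.ofReal (2 * H * ε ^ θ * (k.factorial * C ^ k)) * D.boundaryVol +
        ENNReal.ofReal ((H * ε ^ (θ - 1) * C + H * C) * ((k + 1).factorial * C ^ k)) * D.vol := by
  obtain ⟨F, hF, hFH, hFa, hFL⟩ := exists_contDiff_approx_of_holder hε hH hθ₀.le hθ₁ ha haθ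
  have hF1 : ContDiff ℝ 1 F := hF.of_le (by simp)
  let g : Fin k → M → ℝ := fun l x => L.coord x (I l)
  have hg : ∀ l, ContMDiff (𝓡 n) 𝓘(ℝ, ℝ) 1 (g l) := fun l => L.contMDiff_coord_apply (I l)
  have hpull : L.pullback (fun y => a y - F y) = fun x => L.pullback a x - L.pullback F x :=
    funext fun _ => mul_sub _ _ _
  have herror := L.ofReal_abs_wedgeIntegral_le_boundaryVol D (a := fun y => a y - F y) hC0 hC₁
    (by positivity) (fun y hy => (abs_sub_comm _ _).trans_le (hFa y hy)) I
  rw [hpull, D.wedgeIntegral_sub (L.continuous_pullback hac) (L.contMDiff_pullback hF1).continuous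
    hg] at herror
  have hsmooth := D.ofReal_abs_wedgeIntegral_le_vol (L.contMDiff_pullback hF1) hg hC0
    (by positivity) (fun l => L.abs_mvfderiv_coord_apply_le hC₁ (I l))
    (L.abs_mvfderiv_pullback_le hC₀ hC₁ (hF1.differentiable one_ne_zero) hFH hFL)
  refine le_trans ?_ (add_le_add herror hsmooth)
  rw [← ENNReal.ofReal_add (abs_nonneg _) (abs_nonneg _)]
  refine ENNReal.ofReal_le_ofReal ((abs_add_le _ _).trans_eq' ?_)
  rw [sub_add_cancel]

theorem ofReal_abs_wedgeIntegral_le_rpow_mul_rpow [IsManifold (𝓡 n) 1 M]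
    [IsContinuousRiemannianBundle (EuclideanSpace ℝ (Fin n)) (fun x : M => TangentSpace (𝓡 n) x)]
    {a : EuclideanSpace ℝ (Fin n) → ℝ} {H θ : ℝ} (hC0 : 0 ≤ C)
    (hC₀ : ∀ x (v : TangentSpace (𝓡 n) x), |mvfderiv (𝓡 n) L.cutoff x v| ≤ C * ‖v‖)
    (hC₁ : ∀ x (v : TangentSpace (𝓡 n) x), ‖mvfderiv (𝓡 n) L.coord x v‖ ≤ C * ‖v‖)
    (hH : 0 ≤ H) (hθ₀ : 0 < θ) (hθ₁ : θ ≤ 1) (ha : ∀ y ∈ φ.target, |a y| ≤ H)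
    (haθ : ∀ y ∈ φ.target, ∀ z ∈ φ.target, |a y - a z| ≤ H * dist y z ^ θ)
    (hac : ContinuousOn a φ.target) (I : Fin k → Fin n) :
    ENNReal.ofReal |D.wedgeIntegral (L.pullback a) fun l x => L.coord x (I l)| ≤
      2 * ENNReal.ofReal
          (H * (2 * (k.factorial * C ^ k) + 2 * (C * ((k + 1).factorial * C ^ k)))) *
        D.boundaryVol ^ (1 - θ) * D.vol ^ θ := by
  set c : ℝ := k.factorial * C ^ k
  set d : ℝ := (k + 1).factorial * C ^ k
  have hc : 0 ≤ c := by positivity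
  have hd : 0 ≤ C * d := by positivity
  set K : ℝ := 2 * c + 2 * (C * d)
  have hK : 0 ≤ K := by positivity
  have hcK : 2 * c ≤ K := le_add_of_nonneg_right (by positivity)
  have hdK : 2 * (C * d) ≤ K := le_add_of_nonneg_left (by positivity)
  refine le_rpow_mul_rpow_of_forall_le hθ₀ hθ₁ ENNReal.ofReal_ne_top D.boundaryVol_ne_top ?_
    fun ε hε hε1 => ?_
  · refine (L.ofReal_abs_wedgeIntegral_le_boundaryVol D hC0 hC₁ hH ha I).trans ?_
    gcongr
    linarith
  · have hεθ : 1 ≤ ε ^ (θ - 1) :=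
      Real.one_le_rpow_of_pos_of_le_one_of_nonpos hε hε1 (sub_nonpos.2 hθ₁)
    refine (L.ofReal_abs_wedgeIntegral_le_of_holder D hC0 hC₀ hC₁ hH hθ₀ hθ₁ hε ha haθ hac
      I).trans ?_
    rw [mul_add, ← mul_assoc (ENNReal.ofReal _) (ENNReal.ofReal _) D.boundaryVol,
      ← mul_assoc (ENNReal.ofReal _) (ENNReal.ofReal _) D.vol,
      ← ENNReal.ofReal_mul (mul_nonneg hH hK), ← ENNReal.ofReal_mul (mul_nonneg hH hK)]
    refine add_le_add (mul_le_mul_left (ENNReal.ofReal_le_ofReal ?_) _)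
      (mul_le_mul_left (ENNReal.ofReal_le_ofReal ?_) _)
    · calc 2 * H * ε ^ θ * c = H * (2 * c) * ε ^ θ := by ring
        _ ≤ H * K * ε ^ θ := by gcongr
    · calc (H * ε ^ (θ - 1) * C + H * C) * d
          = H * (C * d) * ε ^ (θ - 1) + H * (C * d) * 1 := by ring
        _ ≤ H * (C * d) * ε ^ (θ - 1) + H * (C * d) * ε ^ (θ - 1) := by gcongr
        _ = H * (2 * (C * d)) * ε ^ (θ - 1) := by ring
        _ ≤ H * K * ε ^ (θ - 1) := by gcongr

theorem exists_ofReal_abs_wedgeIntegral_le [CompactSpace M] [IsManifold (𝓡 n) 1 M]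
    [IsContinuousRiemannianBundle (EuclideanSpace ℝ (Fin n)) (fun x : M => TangentSpace (𝓡 n) x)]
    {θ : ℝ≥0} (hθ₀ : 0 < θ) (hθ₁ : θ ≤ 1) (k : ℕ) :
    ∃ K : ℝ, 0 ≤ K ∧ ∀ a : EuclideanSpace ℝ (Fin n) → ℝ, holderNormOn θ φ.target a ≠ ⊤ →
      ∀ (D : ImmersedDisk n M k) (I : Fin k → Fin n),
        ENNReal.ofReal |D.wedgeIntegral (L.pullback a) fun l x => L.coord x (I l)| ≤
          ENNReal.ofReal K * holderNormOn θ φ.target a *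
            D.boundaryVol ^ (1 - (θ : ℝ)) * D.vol ^ (θ : ℝ) := by
  obtain ⟨C, hC0, hC₀, hC₁⟩ := L.exists_norm_mvfderiv_cutoff_le_and_coord_le
  refine ⟨2 * (2 * (k.factorial * C ^ k) + 2 * (C * ((k + 1).factorial * C ^ k))),
    by positivity, fun a ha D I => ?_⟩
  have hbound := L.ofReal_abs_wedgeIntegral_le_rpow_mul_rpow D hC0 hC₀ hC₁ ENNReal.toReal_nonneg
    (NNReal.coe_pos.2 hθ₀) (NNReal.coe_le_one.2 hθ₁)
    (fun y hy => abs_le_toReal_holderNormOn ha hy)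
    (fun y hy z hz => abs_sub_le_toReal_holderNormOn ha hy hz)
    (continuousOn_of_holderNormOn_ne_top hθ₀ ha) I
  rw [ENNReal.ofReal_mul ENNReal.toReal_nonneg, ENNReal.ofReal_toReal ha] at hbound
  rw [ENNReal.ofReal_mul zero_le_two, ENNReal.ofReal_ofNat]
  exact hbound.trans_eq (by ring)

end LocalizedChart

end LocalizedChart

theorem DiffForm.holderNormOn_coeff_le_holderNorm {n k : ℕ} {M : Type*} [TopologicalSpace M]
    [ChartedSpace (EuclideanSpace ℝ (Fin n)) M]
    {A : Set (OpenPartialHomeomorph M (EuclideanSpace ℝ (Fin n)))} (θ : ℝ≥0) (α : DiffForm n M k)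
    {φ : OpenPartialHomeomorph M (EuclideanSpace ℝ (Fin n))} (hφ : φ ∈ A) (I : Fin k ↪o Fin n) :
    holderNormOn θ φ.target (α.coeff φ I) ≤ DiffForm.holderNorm A θ α :=
  (le_iSup (fun I => holderNormOn θ φ.target (α.coeff φ I)) I).trans
    (le_iSup₂ (f := fun ψ (_ : ψ ∈ A) => ⨆ I : Fin k ↪o Fin n,
      holderNormOn θ ψ.target (α.coeff ψ I)) φ hφ)

theorem theoremA_general {n : ℕ} {M : Type*} [TopologicalSpace M] [T2Space M] [CompactSpace M]
    [ChartedSpace (EuclideanSpace ℝ (Fin n)) M] [IsManifold (𝓡 n) ∞ M]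
    [RiemannianBundle (fun x : M => TangentSpace (𝓡 n) x)]
    [IsContinuousRiemannianBundle (EuclideanSpace ℝ (Fin n)) (fun x : M => TangentSpace (𝓡 n) x)]
    {A : Set (OpenPartialHomeomorph M (EuclideanSpace ℝ (Fin n)))} (hA : IsFiniteAtlas A)
    {θ : ℝ≥0} (hθ₀ : 0 < θ) (hθ₁ : θ ≤ 1) (k : ℕ) :
    ∃ K : ℝ, 0 < K ∧ ∀ α : DiffForm n M k, DiffForm.holderNorm A θ α ≠ ⊤ →
      ∀ D : ImmersedDisk n M k, ENNReal.ofReal |D.boundaryIntegral α| ≤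
        ENNReal.ofReal K * DiffForm.holderNorm A θ α *
          D.boundaryVol ^ (1 - (θ : ℝ)) * D.vol ^ (θ : ℝ) := by
  have : Fintype A := hA.1.fintype
  have hAφ : ∀ φ : A, φ.1 ∈ IsManifold.maximalAtlas (𝓡 n) ∞ M := fun φ => hA.2.1 φ.2
  obtain ⟨L, hL⟩ := exists_localizedChart_sum_cutoff_eq_one hAφ fun x =>
    let ⟨φ, hφ, hx⟩ := hA.2.2 x; ⟨⟨φ, hφ⟩, hx⟩
  choose K hK0 hK using fun φ => (L φ).exists_ofReal_abs_wedgeIntegral_le hθ₀ hθ₁ k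
  have hsum0 : 0 ≤ ∑ φ, ∑ _I : Fin k ↪o Fin n, K φ :=
    Finset.sum_nonneg fun φ _ => Finset.sum_nonneg fun _ _ => hK0 φ
  refine ⟨(∑ φ, ∑ _I : Fin k ↪o Fin n, K φ) + 1, by positivity, fun α hα D => ?_⟩
  have hcoeff := fun (φ : A) (I : Fin k ↪o Fin n) => α.holderNormOn_coeff_le_holderNorm θ φ.2 I
  have hfin := fun φ I => ne_top_of_le_ne_top hα (hcoeff φ I)
  rw [D.boundaryIntegral_eq_sum_wedgeIntegral α hAφ L hL fun φ I =>
    continuousOn_of_holderNormOn_ne_top hθ₀ (hfin φ I), ← Real.enorm_eq_ofReal_abs]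
  calc ‖∑ φ : A, ∑ I : Fin k ↪o Fin n,
          D.wedgeIntegral ((L φ).pullback (α.coeff φ.1 I)) fun l x => (L φ).coord x (I l)‖ₑ
      ≤ ∑ φ : A, ∑ _I : Fin k ↪o Fin n, ENNReal.ofReal (K φ) * DiffForm.holderNorm A θ α *
          D.boundaryVol ^ (1 - (θ : ℝ)) * D.vol ^ (θ : ℝ) := by
        refine (enorm_sum_le _ _).trans (Finset.sum_le_sum fun φ _ =>
          (enorm_sum_le _ _).trans (Finset.sum_le_sum fun I _ => ?_))
        rw [Real.enorm_eq_ofReal_abs]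
        refine (hK φ _ (hfin φ I) D I).trans ?_
        gcongr
        exact hcoeff φ I
    _ = ENNReal.ofReal (∑ φ, ∑ _I : Fin k ↪o Fin n, K φ) * DiffForm.holderNorm A θ α *
          D.boundaryVol ^ (1 - (θ : ℝ)) * D.vol ^ (θ : ℝ) := by
        rw [ENNReal.ofReal_sum_of_nonneg fun φ _ => Finset.sum_nonneg fun _ _ => hK0 φ]
        simp only [ENNReal.ofReal_sum_of_nonneg fun _ _ => hK0 _, Finset.sum_mul]
    _ ≤ _ := by
        gcongr
        exact le_add_of_nonneg_right zero_le_one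

theorem theoremA {n : ℕ} {M : Type*} [EMetricSpace M] [CompactSpace M]
    [ChartedSpace (EuclideanSpace ℝ (Fin n)) M] [IsManifold (𝓡 n) ∞ M]
    [RiemannianBundle (fun x : M => TangentSpace (𝓡 n) x)]
    [IsContMDiffRiemannianBundle (𝓡 n) ∞ (EuclideanSpace ℝ (Fin n))
      (fun x : M => TangentSpace (𝓡 n) x)]
    [IsRiemannianManifold (𝓡 n) M]
    (A : Set (OpenPartialHomeomorph M (EuclideanSpace ℝ (Fin n)))) (hA : IsFiniteAtlas A)
    (θ : ℝ≥0) (hθ₀ : 0 < θ) (hθ₁ : θ < 1) (k : ℕ) (hk₁ : 1 ≤ k) (hkn : k + 1 ≤ n) :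
    ∃ σ K : ℝ, 0 < σ ∧ 0 < K ∧
      ∀ α : DiffForm n M k, DiffForm.holderNorm A θ α ≠ ⊤ →
        ∀ D : ImmersedDisk n M k,
          max (Metric.ediam D.boundary) D.boundaryVol < ENNReal.ofReal σ →
            ENNReal.ofReal |D.boundaryIntegral α| ≤
              ENNReal.ofReal K * DiffForm.holderNorm A θ α *
                D.boundaryVol ^ (1 - (θ : ℝ)) * D.vol ^ (θ : ℝ) := by
  have : IsContinuousRiemannianBundle (EuclideanSpace ℝ (Fin n))
      (fun x : M => TangentSpace (𝓡 n) x) := by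
    obtain ⟨g, hg, hinner⟩ := IsContMDiffRiemannianBundle.exists_contMDiff (IB := 𝓡 n) (n := ∞)
      (F := EuclideanSpace ℝ (Fin n)) (E := fun x : M => TangentSpace (𝓡 n) x)
    exact ⟨g, hg.continuous, hinner⟩
  obtain ⟨K, hK, h⟩ := theoremA_general hA hθ₀ hθ₁.le k
  exact ⟨1, K, one_pos, hK, fun α hα D _ => h α hα D⟩
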